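/- Let $V,H$ be separable real Hilbert spaces with $V$ continuously and densely embedded in $H$, so that $V\subset H\subset V'$, let $U$ be a finite-dimensional Hilbert space, $T>0$, $B\in\mathcal L(U,H)$, $Q,P\in\mathcal L(H)$, $y_\circ\in H$, $f\in L^2(0,T;H)$. Let $\mathfrak S=[-1/2,1/2]^{\mathbb N}$ carry the uniform product probability measure $\mathrm d\sigma$. For $\sigma\in\mathfrak S$ let $\mathcal A_\sigma\in\mathcal L(V,V')$, $\langle\mathcal A_\sigma v,w\rangle=-a(\sigma;v,w)$ with continuous bilinear forms $a(\sigma;\cdot,\cdot)$ on $V$, where $\sigma\mapsto a(\sigma;v,w)$ is measurable for all $v,w\in V$, and put $D(\mathcal A_\sigma)=\{v\in V:\mathcal A_\sigma v\in H\}$. Assume: (i) there are $\rho\in\mathbb R$, $\theta>0$ with $a(\sigma;v,v)+\rho\|v\|_H^2\ge\theta\|v\|_V^2$ for all $v\in V$, $\sigma\in\mathfrak S$; (ii) $\sup_{\sigma\in\mathfrak S}\|\mathcal A_\sigma\|_{\mathcal L(V,V')}<\infty$; (iii) $D(\mathcal A):=D(\mathcal A_\sigma)=D(\mathcal A_\sigma^*)$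 is independent of $\sigma\in\mathfrak S$; it is equipped with the graph norm $(\|v\|_H^2+\|\mathcal A_0v\|_H^2)^{1/2}$; (iv) there are $0<p\le1$ and a nonnegative sequence $\tilde b\in\ell^p(\mathbb N)$ such that all mixed partial derivatives $\partial_\sigma^\nu\mathcal A_\sigma v$, $v\in D(\mathcal A)$, exist in $H$ and $\|\partial^\nu_\sigma\mathcal A_\sigma\|_{\mathcal L(D(\mathcal A),H)}\le\tilde b^\nu=\prod_j\tilde b_j^{\nu_j}$ for all finitely supported multi-indices $\nu\ne0$ and all $\sigma\in\mathfrak S$; (v) $\sup_{\sigma\in\mathfrak S}\|\mathcal A_\sigma\|_{\mathcal L(D(\mathcal A),H)}<\infty$. Let $g\in W^{1,2}(0,T;H)\cap L^2(0,T;D(\mathcal A))$. For $\sigma\in\mathfrak S$ let $\Pi_\sigma$ be the self-adjoint, nonnegative, strongly continuous solution on $[0,T]$ of the Riccati equation $$\dot\Pi_\sigma=\Pi_\sigma\mathcal A_\sigma+\mathcal A_\sigma^*\Pi_\sigma-\Pi_\sigma BB^*\Pi_\sigma+Q^*Q,\qquad \Pi_\sigma(0)=P^*P$$ (tested with elements of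 $D(\mathcal A_\sigma)$), and let $h_\sigma\in W_T(V,V')=\{v\in L^2(0,T;V):\dot v\in L^2(0,T;V')\}$ be the solution of $$-\dot h_\sigma(t)=\big(\mathcal A_\sigma^*-\Pi_\sigma(T-t)BB^*\big)h_\sigma(t)+\Pi_\sigma(T-t)\big(f(t)+\mathcal A_\sigma g(t)-\dot g(t)\big),\qquad h_\sigma(T)=0.$$ Put $B^*\Pi(t)=\int_{\mathfrak S}B^*\Pi_\sigma(t)\,\mathrm d\sigma$, $B^*h(t)=\int_{\mathfrak S}B^*h_\sigma(t)\,\mathrm d\sigma$, and let $K(t,z)=-B^*\Pi(T-t)z-B^*h(t)$ be the mean feedback. For an arbitrary cubature rule with weights $\alpha_1,\dots,\alpha_N\in\mathbb R$ and nodes $x_1,\dots,x_N\in[-1/2,1/2]^s$ put $B^*\hat\Pi=\sum_k\alpha_kB^*\Pi_{(x_k,0)}$, $B^*\hat h=\sum_k\alpha_kB^*h_{(x_k,0)}$, where $(x,0)=(x_1,\dots,x_s,0,0,\dots)$, and $\hat K(t,z)=-B^*\hat\Pi(T-t)z-B^*\hat h(t)$. For $\sigma\in\mathfrak S$ let $y_\sigma,\hat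 y_\sigma\in W_T(V,V')$ (with their representatives in $C([0,T];H)$) be the closed-loop states $$\dot y_\sigma=\mathcal A_\sigma y_\sigma+BK(t,y_\sigma)+f,\qquad \dot{\hat y}_\sigma=\mathcal A_\sigma\hat y_\sigma+B\hat K(t,\hat y_\sigma)+f,\qquad y_\sigma(0)=\hat y_\sigma(0)=y_\circ,$$ and let $u_\sigma(t)=K(t,y_\sigma(t))$, $\hat u_\sigma(t)=\hat K(t,\hat y_\sigma(t))$ be the corresponding controls. Write $B^*\delta\Pi=B^*\Pi-B^*\hat\Pi$ and $B^*\delta h=B^*h-B^*\hat h$. Then there are constants $C_y,C_u$, independent of $\sigma\in\mathfrak S$ and depending on the cubature rule only through an upper bound for $\sum_k|\alpha_k|$, such that for all $\sigma\in\mathfrak S$ and $t\in[0,T]$ $$\|y_\sigma(t)-\hat y_\sigma(t)\|_H\le C_y\max_{\tau\in[0,T]}\big(\|B^*\delta\Pi(T-\tau)\|_{\mathcal L(H,U)}+\|B^*\delta h(\tau)\|_U\big),$$ $$\|u_\sigma(t)-\hat u_\sigma(t)\|_U\le C_u\max_{\tau\in[0,T]}\big(\|B^*\delta\Pi(T-\tau)\|_{\mathcal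 L(H,U)}+\|B^*\delta h(\tau)\|_U\big).$$ -/

import Mathlib

open MeasureTheory
open scoped RealInnerProductSpace

namespace FeedbackUQ

noncomputable section

/-! ### The parameter domain `[-1/2, 1/2]^ℕ` and its uniform product measure -/

/-- The parameter domain `𝔖 = [-1/2, 1/2]^ℕ`. -/
def paramDomain : Set (ℕ → ℝ) := {σ | ∀ j, σ j ∈ Set.Icc (-1 / 2 : ℝ) (1 / 2)}

/-- The uniform distribution on `[-1/2, 1/2]`. -/
def coordMeasure : Measure ℝ := volume.restrict (Set.Icc (-1 / 2 : ℝ) (1 / 2))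

instance : IsProbabilityMeasure coordMeasure := by
  constructor
  simp only [coordMeasure, Measure.restrict_apply MeasurableSet.univ, Set.univ_inter,
    Real.volume_Icc]
  norm_num

/-- The uniform product probability measure `dσ = ⨂ dσ_j` (carried by `paramDomain`). -/
def paramMeasure : Measure (ℕ → ℝ) := Measure.infinitePi fun _ => coordMeasure

/-- The point `(x, 0) = (x_1, …, x_s, 0, 0, …)`. -/
def zeroExt {s : ℕ} (x : Fin s → ℝ) : ℕ → ℝ := fun j => if hj : j < s then x ⟨j, hj⟩ else 0

/-- `D ν σ`, for finitely supported multi-indices `ν`, are the mixed partial derivatives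
`∂^ν F (σ)` of `F` on the parameter domain (one-sided at the ends of `[-1/2, 1/2]`);
in particular all of them exist. -/
def IsMixedPartials {E : Type*} [NormedAddCommGroup E] [NormedSpace ℝ E]
    (F : (ℕ → ℝ) → E) (D : (ℕ →₀ ℕ) → (ℕ → ℝ) → E) : Prop :=
  (∀ σ ∈ paramDomain, D 0 σ = F σ) ∧
  ∀ (ν : ℕ →₀ ℕ) (j : ℕ), ∀ σ ∈ paramDomain,
    HasDerivWithinAt (fun s : ℝ => D ν (Function.update σ j s)) (D (ν + Finsupp.single j 1) σ)
      (Set.Icc (-1 / 2 : ℝ) (1 / 2)) (σ j)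

/-! ### Gelfand triple `V ⊂ H ⊂ V'` and the spaces `W_T(V, V')` -/

section Triple

variable {V H : Type*} [NormedAddCommGroup V] [InnerProductSpace ℝ V]
  [NormedAddCommGroup H] [InnerProductSpace ℝ H]

/-- The embedding `H ⊂ V'` belonging to `ι : V → H`: `⟨x, w⟩_{V',V} = ⟨x, ι w⟩_H`. -/
def dualEmb (ι : V →L[ℝ] H) : H →L[ℝ] StrongDual ℝ V :=
  ((ContinuousLinearMap.compL ℝ V H ℝ).flip ι).comp (innerSL ℝ)

theorem dualEmb_apply (ι : V →L[ℝ] H) (x : H) (w : V) : dualEmb ι x w = ⟪x, ι w⟫ := rfl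

/-- The domain `D(L) = {v ∈ V : L v ∈ H}` of the part in `H` of an operator `L : V → V'`. -/
def domH (ι : V →L[ℝ] H) (L : V →L[ℝ] StrongDual ℝ V) : Submodule ℝ V :=
  (LinearMap.range (dualEmb ι : H →ₗ[ℝ] StrongDual ℝ V)).comap (L : V →ₗ[ℝ] StrongDual ℝ V)

open Classical in
/-- `L v` as an element of `H`, for `v ∈ D(L)` (and `0` for other `v`). -/
def partH (ι : V →L[ℝ] H) (L : V →L[ℝ] StrongDual ℝ V) (v : V) : H :=
  if hv : ∃ z, dualEmb ι z = L v then hv.choose else 0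

theorem dualEmb_injective {ι : V →L[ℝ] H} (hι : DenseRange ι) :
    Function.Injective (dualEmb ι) := by
  intro x y hxy
  refine hι.eq_of_inner_left ℝ fun w => ?_
  exact congrArg (fun l : StrongDual ℝ V => l w) hxy

theorem dualEmb_partH {ι : V →L[ℝ] H} {L : V →L[ℝ] StrongDual ℝ V} {v : V}
    (hv : v ∈ domH ι L) : dualEmb ι (partH ι L v) = L v := by
  have h : ∃ z, dualEmb ι z = L v := by simpa [domH] using hv
  rw [partH, dif_pos h]
  exact h.choose_spec

/-- The graph norm of the part of `L` in `H`. -/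
def graphNorm (ι : V →L[ℝ] H) (L : V →L[ℝ] StrongDual ℝ V) (v : V) : ℝ :=
  Real.sqrt (‖ι v‖ ^ 2 + ‖partH ι L v‖ ^ 2)

/-- `u'` is the weak derivative of `u` on `(0, T)`. -/
def HasWeakDeriv {E : Type*} [NormedAddCommGroup E] [NormedSpace ℝ E]
    (T : ℝ) (u u' : ℝ → E) : Prop :=
  ∀ φ : ℝ → ℝ, ContDiff ℝ (⊤ : ℕ∞) φ → HasCompactSupport φ → tsupport φ ⊆ Set.Ioo 0 T →
    ∫ t in Set.Ioo 0 T, deriv φ t • u t = - ∫ t in Set.Ioo 0 T, φ t • u' t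

/-- `y ∈ W_T(V, V')`: `y` is the representative in `C([0,T]; H)`, `yV ∈ L²(0,T; V)` is `y` seen
as a `V`-valued function and `dy ∈ L²(0,T; V')` is the weak derivative. -/
structure MemW (ι : V →L[ℝ] H) (T : ℝ) (y : ℝ → H) (yV : ℝ → V) (dy : ℝ → StrongDual ℝ V) :
    Prop where
  continuousOn : ContinuousOn y (Set.Icc 0 T)
  repr : ∀ᵐ t ∂volume.restrict (Set.Ioo 0 T), ι (yV t) = y t
  memLp : MemLp yV 2 (volume.restrict (Set.Ioo 0 T))
  memLp_deriv : MemLp dy 2 (volume.restrict (Set.Ioo 0 T))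
  weakDeriv : HasWeakDeriv T (fun t => dualEmb ι (y t)) dy

/-- `g ∈ W^{1,2}(0,T; H) ∩ L²(0,T; D(L))` with weak derivative `dg`. -/
structure IsRegularTarget (ι : V →L[ℝ] H) (L : V →L[ℝ] StrongDual ℝ V) (T : ℝ)
    (g : ℝ → V) (dg : ℝ → H) : Prop where
  mem_dom : ∀ᵐ t ∂volume.restrict (Set.Ioo 0 T), g t ∈ domH ι L
  memLp : MemLp (fun t => ι (g t)) 2 (volume.restrict (Set.Ioo 0 T))
  memLp_op : MemLp (fun t => partH ι L (g t)) 2 (volume.restrict (Set.Ioo 0 T))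
  memLp_deriv : MemLp dg 2 (volume.restrict (Set.Ioo 0 T))
  weakDeriv : HasWeakDeriv T (fun t => ι (g t)) dg

end Triple

/-! ### Feedback: Riccati equation, affine term, mean and cubature, closed loop -/

section Feedback

variable {V H U : Type*} [NormedAddCommGroup V] [InnerProductSpace ℝ V]
  [NormedAddCommGroup H] [InnerProductSpace ℝ H] [CompleteSpace H]
  [NormedAddCommGroup U] [InnerProductSpace ℝ U] [CompleteSpace U]

/-- `S` is a self-adjoint nonnegative, strongly continuous solution on `[0, T]` of
`S' = S L + L* S - S B B* S + Q* Q`, `S(0) = P* P`, the equation being understood, as usual for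
unbounded `L`, in the form `⟨S x, x'⟩' = …` for `x, x' ∈ D(L)`. -/
structure IsRiccatiSolution (ι : V →L[ℝ] H) (L : V →L[ℝ] StrongDual ℝ V) (B : U →L[ℝ] H)
    (Q P : H →L[ℝ] H) (T : ℝ) (S : ℝ → H →L[ℝ] H) : Prop where
  isPositive : ∀ t ∈ Set.Icc 0 T, (S t).IsPositive
  continuousOn : ∀ x : H, ContinuousOn (fun t => S t x) (Set.Icc 0 T)
  initial : S 0 = (ContinuousLinearMap.adjoint P).comp P
  hasDeriv : ∀ x ∈ domH ι L, ∀ x' ∈ domH ι L, ∀ t ∈ Set.Icc 0 T,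
    HasDerivWithinAt (fun s => ⟪S s (ι x), ι x'⟫)
      (⟪S t (partH ι L x), ι x'⟫ + ⟪S t (ι x), partH ι L x'⟫
        - ⟪S t (B (ContinuousLinearMap.adjoint B (S t (ι x)))), ι x'⟫
        + ⟪ContinuousLinearMap.adjoint Q (Q (ι x)), ι x'⟫)
      (Set.Icc 0 T) t

/-- `h ∈ W_T(V, V')` solves `-h' = (L* - S(T-t) B B*) h + S(T-t) r`, `h(T) = 0`, where
`r = f + L g - g'` and `dg` stands for `g'`. -/
def IsAffineTerm (ι : V →L[ℝ] H) (L : V →L[ℝ] StrongDual ℝ V) (B : U →L[ℝ] H) (T : ℝ)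
    (f : ℝ → H) (g : ℝ → V) (dg : ℝ → H) (S : ℝ → H →L[ℝ] H) (h : ℝ → H) : Prop :=
  ∃ (hV : ℝ → V) (dh : ℝ → StrongDual ℝ V), MemW ι T h hV dh ∧ h T = 0 ∧
    ∀ᵐ t ∂volume.restrict (Set.Ioo 0 T),
      - dh t = L.flip (hV t)
        - dualEmb ι (S (T - t) (B (ContinuousLinearMap.adjoint B (h t))))
        + dualEmb ι (S (T - t) (f t + partH ι L (g t) - dg t))

/-- `B* Π(t) = ∫ B* Π_σ(t) dσ` in `L(H, U)`. -/
def meanLin (B : U →L[ℝ] H) (S : (ℕ → ℝ) → ℝ → H →L[ℝ] H) (t : ℝ) : H →L[ℝ] U :=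
  ∫ σ in paramDomain, (ContinuousLinearMap.adjoint B).comp (S σ t) ∂paramMeasure

/-- `B* h(t) = ∫ B* h_σ(t) dσ` in `U`. -/
def meanAff (B : U →L[ℝ] H) (h : (ℕ → ℝ) → ℝ → H) (t : ℝ) : U :=
  ∫ σ in paramDomain, ContinuousLinearMap.adjoint B (h σ t) ∂paramMeasure

/-- `∑ k, α_k B* Π_{(x_k, 0)}(t)`, for a cubature rule with weights `α` and `s`-dimensional
nodes `x`. -/
def cubLin (B : U →L[ℝ] H) (S : (ℕ → ℝ) → ℝ → H →L[ℝ] H) {N s : ℕ} (α : Fin N → ℝ)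
    (x : Fin N → Fin s → ℝ) (t : ℝ) : H →L[ℝ] U :=
  ∑ k, α k • (ContinuousLinearMap.adjoint B).comp (S (zeroExt (x k)) t)

/-- `∑ k, α_k B* h_{(x_k, 0)}(t)`. -/
def cubAff (B : U →L[ℝ] H) (h : (ℕ → ℝ) → ℝ → H) {N s : ℕ} (α : Fin N → ℝ)
    (x : Fin N → Fin s → ℝ) (t : ℝ) : U :=
  ∑ k, α k • ContinuousLinearMap.adjoint B (h (zeroExt (x k)) t)

/-- The affine feedback `(t, z) ↦ -M(T-t) z - m(t)`, where `M` plays the part of `B* Π` and `m`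
that of `B* h`. -/
def affineFeedback (T : ℝ) (M : ℝ → H →L[ℝ] U) (m : ℝ → U) (t : ℝ) (z : H) : U :=
  - M (T - t) z - m t

/-- `y ∈ W_T(V, V')` solves `y' = L y + B K(t, y) + f`, `y(0) = y₀`. -/
def IsClosedLoop (ι : V →L[ℝ] H) (L : V →L[ℝ] StrongDual ℝ V) (B : U →L[ℝ] H) (T : ℝ)
    (f : ℝ → H) (y₀ : H) (K : ℝ → H → U) (y : ℝ → H) : Prop :=
  ∃ (yV : ℝ → V) (dy : ℝ → StrongDual ℝ V), MemW ι T y yV dy ∧ y 0 = y₀ ∧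
    ∀ᵐ t ∂volume.restrict (Set.Ioo 0 T),
      dy t = L (yV t) + dualEmb ι (B (K t (y t)) + f t)

/-- `max_{t ∈ [0,T]} (‖M(T-t) - M'(T-t)‖ + ‖m(t) - m'(t)‖)`. -/
def maxFeedbackError (T : ℝ) (M M' : ℝ → H →L[ℝ] U) (m m' : ℝ → U) : ℝ :=
  ⨆ t : Set.Icc (0 : ℝ) T, (‖M (T - t) - M' (T - t)‖ + ‖m t - m' t‖)

end Feedback

end

end FeedbackUQ

open FeedbackUQ

/-! The difference of the two closed-loop states starts at zero and solves the state equation with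
forcing `B (K(t, y) - K'(t, y'))`. Splitting this as the perturbed feedback acting on the difference
plus the feedback error evaluated at `y`, an energy estimate and Grönwall give Lipschitz dependence
on the feedback error. The point is that all constants are uniform in the parameter and the cubature
nodes, which requires a priori bounds for `‖Π_σ(t)‖`, `‖h_σ(t)‖` and `‖y_σ(t)‖` in terms of the data
alone.

The Riccati bound (`IsRiccatiSolution.norm_le`) is the optimal control bound: `⟪Π_σ(t) x, x⟫` is at
most the cost of the zero control. No semigroup is used. The uncontrolled flow is replaced by
backward Euler steps with the resolvent `K = (1 - τ L)⁻¹`, obtained from Lax–Milgram in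
`exists_resolvent`. Along one step `⟪S x, x⟫` grows by at most `τ ‖Q‖² ‖x‖² + O(τ²)`, because the
quadratic term of the equation has a favourable sign. Summing `n` steps and letting `n → ∞` leaves
`‖P‖² + T ‖Q‖²` times a growth factor, first on the domain of the square of the generator and then
by density.

The bounds for `h_σ`, `y_σ` and the state difference all come from `energy_inequality`: in
integrated form `‖y‖' ≤ ρ ‖y‖ + ‖F‖` for `y' = L y + F`. It is proved by testing with Steklov
averages of `y`, which lie in `V` and are differentiable in `H`, so that no chain rule for `‖y‖²` in
`W_T(V, V')` is needed; the only input is that weak derivatives integrate back to increments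
(`HasWeakDeriv.sub_eq_integral`). A sign `e = ±1` covers the forward and backward equations
together. -/

open FeedbackUQ
open Filter Topology

/-! ### Weak derivatives and primitives -/

/-- A smooth monotone step from `0` to `1` on `[s, s + 1/n]`. -/
noncomputable def smoothStep (n : ℕ) (s x : ℝ) : ℝ := Real.smoothTransition (n * (x - s))

theorem contDiff_smoothStep (n : ℕ) (s : ℝ) : ContDiff ℝ (⊤ : ℕ∞) (smoothStep n s) :=
  Real.smoothTransition.contDiff.comp (by fun_prop)

theorem smoothStep_eq_zero (n : ℕ) {s x : ℝ} (h : x ≤ s) : smoothStep n s x = 0 :=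
  Real.smoothTransition.zero_of_nonpos
    (mul_nonpos_of_nonneg_of_nonpos n.cast_nonneg (sub_nonpos.2 h))

theorem smoothStep_eq_one {n : ℕ} {s x : ℝ} (h : 1 ≤ n * (x - s)) : smoothStep n s x = 1 :=
  Real.smoothTransition.one_of_one_le h

theorem smoothStep_nonneg (n : ℕ) (s x : ℝ) : 0 ≤ smoothStep n s x :=
  Real.smoothTransition.nonneg _

theorem smoothStep_le_one (n : ℕ) (s x : ℝ) : smoothStep n s x ≤ 1 :=
  Real.smoothTransition.le_one _

theorem deriv_smoothStep_eq_zero_left (n : ℕ) {s x : ℝ} (h : x ≤ s) :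
    deriv (smoothStep n s) x = 0 := by
  refine IsLocalMin.deriv_eq_zero (Eventually.of_forall fun y => ?_)
  rw [smoothStep_eq_zero n h]
  exact smoothStep_nonneg n s y

theorem deriv_smoothStep_eq_zero_right {n : ℕ} {s x : ℝ} (h : 1 ≤ n * (x - s)) :
    deriv (smoothStep n s) x = 0 := by
  refine IsLocalMax.deriv_eq_zero (Eventually.of_forall fun y => ?_)
  rw [smoothStep_eq_one h]
  exact smoothStep_le_one n s y

theorem deriv_smoothStep_nonneg (n : ℕ) (s x : ℝ) : 0 ≤ deriv (smoothStep n s) x := by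
  refine Monotone.deriv_nonneg fun y z hyz => Real.smoothTransition.monotone ?_
  have : (0 : ℝ) ≤ n := n.cast_nonneg
  nlinarith

theorem continuous_deriv_smoothStep (n : ℕ) (s : ℝ) : Continuous (deriv (smoothStep n s)) :=
  (contDiff_smoothStep n s).continuous_deriv (by simp)

theorem eventually_one_le_nat_mul {δ : ℝ} (hδ : 0 < δ) : ∀ᶠ n : ℕ in atTop, 1 ≤ n * δ := by
  filter_upwards [eventually_ge_atTop ⌈1 / δ⌉₊] with n hn
  have := Nat.ceil_le.1 hn
  rwa [div_le_iff₀ hδ] at this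

section

variable {E : Type*} [NormedAddCommGroup E] [NormedSpace ℝ E]

/-- The derivatives of the steps form an approximate identity: nonnegative, of integral one, and
concentrated just to the right of `s`. -/
theorem tendsto_integral_deriv_smoothStep [CompleteSpace E] {T s : ℝ} (hs : s ∈ Set.Ioo 0 T) {u : ℝ → E}
    (hu : ContinuousOn u (Set.Icc 0 T)) :
    Tendsto (fun n : ℕ => ∫ x in Set.Ioo 0 T, deriv (smoothStep n s) x • u x) atTop
      (𝓝 (u s)) := by
  rw [Metric.tendsto_atTop']
  intro ε hε
  have hcont : ContinuousAt u s := hu.continuousAt (Icc_mem_nhds hs.1 hs.2)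
  obtain ⟨δ₁, hδ₁, h₁⟩ := Metric.continuousAt_iff.1 hcont (ε / 2) (half_pos hε)
  obtain ⟨δ, hδ, hδ1, hδT⟩ : ∃ δ, 0 < δ ∧ δ < δ₁ ∧ s + δ < T := by
    refine ⟨min (δ₁ / 2) ((T - s) / 2), ?_, ?_, ?_⟩
    · exact lt_min (half_pos hδ₁) (half_pos (sub_pos.2 hs.2))
    · exact (min_le_left _ _).trans_lt (half_lt_self hδ₁)
    · have := min_le_right (δ₁ / 2) ((T - s) / 2)
      linarith [hs.2]
  have hsδ : s ≤ s + δ := by linarith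
  obtain ⟨n₀, hn₀⟩ := eventually_atTop.1 (eventually_one_le_nat_mul hδ)
  refine ⟨n₀, fun n hn => ?_⟩
  have hn1 : 1 ≤ n * δ := hn₀ n hn.le
  have hsub : Set.Ioc s (s + δ) ⊆ Set.Ioo 0 T := fun x hx =>
    ⟨hs.1.trans hx.1, hx.2.trans_lt hδT⟩
  have heq : ∫ x in Set.Ioo 0 T, deriv (smoothStep n s) x • u x
      = ∫ x in s..s + δ, deriv (smoothStep n s) x • u x := by
    rw [intervalIntegral.integral_of_le hsδ]
    refine (setIntegral_eq_of_subset_of_forall_sdiff_eq_zero measurableSet_Ioo hsub ?_)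
    intro x hx
    rcases le_or_gt x s with h | h
    · rw [deriv_smoothStep_eq_zero_left n h, zero_smul]
    · have hx2 : s + δ < x := by
        by_contra hc
        exact hx.2 ⟨h, not_lt.1 hc⟩
      rw [deriv_smoothStep_eq_zero_right, zero_smul]
      have : (0 : ℝ) ≤ n := n.cast_nonneg
      nlinarith
  have hφi : IntervalIntegrable (deriv (smoothStep n s)) volume s (s + δ) :=
    (continuous_deriv_smoothStep n s).intervalIntegrable _ _
  have hone : ∫ x in s..s + δ, deriv (smoothStep n s) x = 1 := by
    rw [intervalIntegral.integral_deriv_eq_sub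
      (fun x _ => (contDiff_smoothStep n s).differentiable (by simp) x) hφi,
      smoothStep_eq_zero n le_rfl, smoothStep_eq_one (by simpa using hn1), sub_zero]
  have hucont : ContinuousOn u (Set.uIcc s (s + δ)) := by
    rw [Set.uIcc_of_le hsδ]
    exact hu.mono fun x hx => ⟨hs.1.le.trans hx.1, hx.2.trans hδT.le⟩
  have hui : IntervalIntegrable (fun x => deriv (smoothStep n s) x • u x) volume s (s + δ) :=
    ((continuous_deriv_smoothStep n s).continuousOn.smul hucont).intervalIntegrable
  have hci : IntervalIntegrable (fun x => deriv (smoothStep n s) x • u s) volume s (s + δ) :=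
    ((continuous_deriv_smoothStep n s).smul continuous_const).intervalIntegrable _ _
  have hdiff : (∫ x in s..s + δ, deriv (smoothStep n s) x • u x) - u s
      = ∫ x in s..s + δ, deriv (smoothStep n s) x • (u x - u s) := by
    simp_rw [smul_sub]
    rw [intervalIntegral.integral_sub hui hci,
      intervalIntegral.integral_smul_const, hone, one_smul]
  rw [heq, dist_eq_norm, hdiff]
  have hbound : ‖∫ x in s..s + δ, deriv (smoothStep n s) x • (u x - u s)‖
      ≤ ∫ x in s..s + δ, deriv (smoothStep n s) x * (ε / 2) := by
    refine intervalIntegral.norm_integral_le_of_norm_le hsδ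
      (Eventually.of_forall fun x hx => ?_) (hφi.mul_const _)
    rw [norm_smul, Real.norm_of_nonneg (deriv_smoothStep_nonneg n s x)]
    refine mul_le_mul_of_nonneg_left ?_ (deriv_smoothStep_nonneg n s x)
    rw [← dist_eq_norm]
    refine (h₁ ?_).le
    rw [Real.dist_eq, abs_of_pos (sub_pos.2 hx.1)]
    linarith [hx.2]
  rw [intervalIntegral.integral_mul_const, hone, one_mul] at hbound
  linarith

theorem tendsto_integral_smoothStep {T s : ℝ} (hs : s ∈ Set.Ioo 0 T) {v : ℝ → E}
    (hv : IntegrableOn v (Set.Ioo 0 T)) :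
    Tendsto (fun n : ℕ => ∫ x in Set.Ioo 0 T, smoothStep n s x • v x) atTop
      (𝓝 (∫ x in Set.Ioo s T, v x)) := by
  have hlim : ∫ x in Set.Ioo s T, v x
      = ∫ x in Set.Ioo 0 T, (Set.Ioo s T).indicator v x := by
    rw [setIntegral_indicator measurableSet_Ioo, Set.inter_eq_self_of_subset_right]
    exact Set.Ioo_subset_Ioo_left hs.1.le
  rw [hlim]
  refine tendsto_integral_of_dominated_convergence (fun x => ‖v x‖) (fun n => ?_) hv.norm
    (fun n => Eventually.of_forall fun x => ?_) ?_
  · exact (contDiff_smoothStep n s).continuous.aestronglyMeasurable.smul hv.aestronglyMeasurable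
  · rw [norm_smul, Real.norm_of_nonneg (smoothStep_nonneg n s x)]
    exact mul_le_of_le_one_left (norm_nonneg _) (smoothStep_le_one n s x)
  · filter_upwards [ae_restrict_mem measurableSet_Ioo] with x hx
    by_cases h : s < x
    · rw [Set.indicator_of_mem (show x ∈ Set.Ioo s T from ⟨h, hx.2⟩)]
      refine tendsto_const_nhds.congr' ?_
      filter_upwards [eventually_one_le_nat_mul (sub_pos.2 h)] with n hn
      rw [smoothStep_eq_one hn, one_smul]
    · rw [Set.indicator_of_notMem (fun hx' => h hx'.1)]
      refine tendsto_const_nhds.congr fun n => ?_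
      rw [smoothStep_eq_zero n (not_lt.1 h), zero_smul]

/-- Testing with the difference of a step at `s` and a step at `t`, a smoothed indicator of `(s,
t]`, and sharpening the steps turns the weak identity into the fundamental theorem of calculus. -/
theorem FeedbackUQ.HasWeakDeriv.sub_eq_integral [CompleteSpace E] {T : ℝ} {u v : ℝ → E} (h : HasWeakDeriv T u v)
    (hu : ContinuousOn u (Set.Icc 0 T)) (hv : IntegrableOn v (Set.Ioo 0 T)) {s t : ℝ}
    (hs : s ∈ Set.Ioo 0 T) (ht : t ∈ Set.Ioo 0 T) (hst : s ≤ t) :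
    u t - u s = ∫ x in s..t, v x := by
  have hui : IntegrableOn u (Set.Ioo 0 T) :=
    (hu.integrableOn_Icc).mono_set Set.Ioo_subset_Icc_self
  have hint : ∀ (n : ℕ) (r : ℝ),
      IntegrableOn (fun x => deriv (smoothStep n r) x • u x) (Set.Ioo 0 T) := fun n r =>
    (((continuous_deriv_smoothStep n r).continuousOn.smul hu).integrableOn_Icc).mono_set
      Set.Ioo_subset_Icc_self
  have hint' : ∀ (n : ℕ) (r : ℝ),
      IntegrableOn (fun x => smoothStep n r x • v x) (Set.Ioo 0 T) := fun n r =>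
    hv.bdd_smul 1 (contDiff_smoothStep n r).continuous.aestronglyMeasurable
      (Eventually.of_forall fun x => by
        rw [Real.norm_of_nonneg (smoothStep_nonneg n r x)]; exact smoothStep_le_one n r x)
  have key : ∀ᶠ n : ℕ in atTop,
      (∫ x in Set.Ioo 0 T, deriv (smoothStep n s) x • u x)
        - (∫ x in Set.Ioo 0 T, deriv (smoothStep n t) x • u x)
      = -((∫ x in Set.Ioo 0 T, smoothStep n s x • v x)
        - ∫ x in Set.Ioo 0 T, smoothStep n t x • v x) := by
    have hδ : 0 < (T - t) / 2 := half_pos (sub_pos.2 ht.2)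
    filter_upwards [eventually_one_le_nat_mul hδ] with n hn
    -- Both steps equal one from the midpoint of `[t, T]` on, so their difference has compact
    -- support inside `(0, T)`.
    have hsupp : Function.support (fun x => smoothStep n s x - smoothStep n t x)
        ⊆ Set.Icc s (t + (T - t) / 2) := by
      intro x hx
      by_contra hc
      apply hx
      have hn0 : (0 : ℝ) ≤ n := n.cast_nonneg
      rw [Set.mem_Icc, not_and_or, not_le, not_le] at hc
      rcases hc with hc | hc
      · simp [smoothStep_eq_zero n hc.le, smoothStep_eq_zero n (hc.le.trans hst)]
      · have h1 : 1 ≤ n * (x - t) := by nlinarith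
        have h2 : 1 ≤ n * (x - s) := by nlinarith
        simp [smoothStep_eq_one h1, smoothStep_eq_one h2]
    have htsupp : tsupport (fun x => smoothStep n s x - smoothStep n t x)
        ⊆ Set.Icc s (t + (T - t) / 2) := closure_minimal hsupp isClosed_Icc
    have := h (fun x => smoothStep n s x - smoothStep n t x)
      ((contDiff_smoothStep n s).sub (contDiff_smoothStep n t))
      (HasCompactSupport.of_support_subset_isCompact isCompact_Icc hsupp)
      (htsupp.trans fun x hx => ⟨hs.1.trans_le hx.1, hx.2.trans_lt (by linarith [ht.2])⟩)
    have hderiv : ∀ x, deriv (fun x => smoothStep n s x - smoothStep n t x) x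
        = deriv (smoothStep n s) x - deriv (smoothStep n t) x := fun x =>
      deriv_fun_sub ((contDiff_smoothStep n s).differentiable (by simp) x)
        ((contDiff_smoothStep n t).differentiable (by simp) x)
    simp_rw [hderiv, sub_smul] at this
    rwa [integral_sub (hint n s) (hint n t), integral_sub (hint' n s) (hint' n t)] at this
  have hlim := tendsto_nhds_unique
    (((tendsto_integral_deriv_smoothStep hs hu).sub
      (tendsto_integral_deriv_smoothStep ht hu)).congr' key)
    ((tendsto_integral_smoothStep hs hv).sub (tendsto_integral_smoothStep ht hv)).neg
  have hsplit : ∫ x in Set.Ioo s T, v x = (∫ x in s..t, v x) + ∫ x in Set.Ioo t T, v x := by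
    have hU : Set.Ioc s t ∪ Set.Ioo t T = Set.Ioo s T := Set.Ioc_union_Ioo_eq_Ioo hst ht.2
    rw [← hU, setIntegral_union _ measurableSet_Ioo, intervalIntegral.integral_of_le hst]
    · exact hv.mono_set fun x hx => ⟨hs.1.trans hx.1, hx.2.trans_lt ht.2⟩
    · exact hv.mono_set (Set.Ioo_subset_Ioo_left ht.1.le)
    · exact Set.disjoint_left.2 fun x hx hx' => not_lt.2 hx.2 hx'.1
  rw [hsplit, add_sub_cancel_right] at hlim
  rw [← neg_sub, hlim, neg_neg]

end

/-! ### Steklov averages -/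

section Steklov

variable {E : Type*} [NormedAddCommGroup E] [NormedSpace ℝ E]

/-- The Steklov average `h⁻¹ ∫_t^{t+h} y`. -/
noncomputable def steklov (h : ℝ) (y : ℝ → E) (t : ℝ) : E := h⁻¹ • ∫ r in t..t + h, y r

theorem hasDerivAt_steklov [CompleteSpace E] (h : ℝ) {y : ℝ → E} (hy : Continuous y) (t : ℝ) :
    HasDerivAt (steklov h y) (h⁻¹ • (y (t + h) - y t)) t := by
  have hP : ∀ t, HasDerivAt (fun t => ∫ r in (0 : ℝ)..t, y r) (y t) t := fun t =>
    intervalIntegral.integral_hasDerivAt_right (hy.intervalIntegrable _ _)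
      (hy.stronglyMeasurableAtFilter _ _) hy.continuousAt
  have heq : steklov h y = fun t =>
      h⁻¹ • ((∫ r in (0 : ℝ)..t + h, y r) - ∫ r in (0 : ℝ)..t, y r) := by
    funext t
    rw [steklov, intervalIntegral.integral_interval_sub_left (hy.intervalIntegrable _ _)
      (hy.intervalIntegrable _ _)]
  rw [heq]
  exact (((hP (t + h)).comp_add_const t h).sub (hP t)).const_smul h⁻¹

theorem tendsto_steklov [CompleteSpace E] {y : ℝ → E} (hy : Continuous y) (t : ℝ) :
    Tendsto (fun h => steklov h y t) (𝓝[>] 0) (𝓝 (y t)) := by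
  have hP : HasDerivAt (fun t => ∫ r in (0 : ℝ)..t, y r) (y t) t :=
    intervalIntegral.integral_hasDerivAt_right (hy.intervalIntegrable _ _)
      (hy.stronglyMeasurableAtFilter _ _) hy.continuousAt
  refine (hP.tendsto_slope_zero_right).congr fun h => ?_
  rw [steklov, intervalIntegral.integral_interval_sub_left (hy.intervalIntegrable _ _)
      (hy.intervalIntegrable _ _)]

end Steklov

/-! ### An energy inequality -/

/-- Both points are moved towards each other by a small fraction of their distance, hence into the
open interval, and continuity recovers the ends. -/
theorem antitoneOn_Icc_of_Ioo {G : ℝ → ℝ} (hG : Continuous G) {T : ℝ}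
    (h : AntitoneOn G (Set.Ioo 0 T)) : AntitoneOn G (Set.Icc 0 T) := by
  intro s hs t ht hst
  rcases hst.eq_or_lt with rfl | hlt
  · exact le_rfl
  have hc : ∀ a b : ℝ, Tendsto (fun l : ℝ => G (a + l * (b - a))) (𝓝[>] 0) (𝓝 (G a)) := by
    intro a b
    have : Continuous fun l : ℝ => G (a + l * (b - a)) := by fun_prop
    simpa using (this.tendsto 0).mono_left nhdsWithin_le_nhds
  refine le_of_tendsto_of_tendsto (hc t s) (hc s t) ?_
  filter_upwards [Ioo_mem_nhdsGT (show (0 : ℝ) < 1 / 2 by norm_num)] with l hl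
  refine h ⟨?_, ?_⟩ ⟨?_, ?_⟩ ?_ <;> nlinarith [hs.1, hs.2, ht.1, ht.2, hl.1, hl.2]

section Energy

variable {V H : Type*} [NormedAddCommGroup V] [InnerProductSpace ℝ V] [CompleteSpace V]
  [NormedAddCommGroup H] [InnerProductSpace ℝ H] [CompleteSpace H]

/-- If `e d = L y + F` with `d` the derivative of `y` in `V'` and `‖F‖ ≤ k`, then
`e (‖y‖)' ≤ ρ ‖y‖ + k` in integrated form. -/
theorem energy_inequality (ι : V →L[ℝ] H) (L : V →L[ℝ] StrongDual ℝ V) {T ρ e : ℝ} (hρ : 0 ≤ ρ)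
    (hL : ∀ v, L v v ≤ ρ * ‖ι v‖ ^ 2) {y : ℝ → H} {yV : ℝ → V} {d : ℝ → StrongDual ℝ V}
    {k : ℝ → ℝ} (hy : ContinuousOn y (Set.Icc 0 T))
    (hrepr : ∀ᵐ t ∂volume.restrict (Set.Ioo 0 T), ι (yV t) = y t)
    (hyV : IntegrableOn yV (Set.Ioo 0 T)) (hd : IntegrableOn d (Set.Ioo 0 T))
    (hyd : ∀ s ∈ Set.Ioo 0 T, ∀ t ∈ Set.Ioo 0 T, s ≤ t →
      dualEmb ι (y t) - dualEmb ι (y s) = ∫ x in s..t, d x)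
    (hk : IntegrableOn k (Set.Ioo 0 T))
    (heq : ∀ᵐ t ∂volume.restrict (Set.Ioo 0 T),
      ∃ F : H, e • d t = L (yV t) + dualEmb ι F ∧ ‖F‖ ≤ k t)
    {s t : ℝ} (hs : 0 ≤ s) (hst : s ≤ t) (ht : t ≤ T) :
    e * (‖y t‖ - ‖y s‖) ≤ ∫ r in s..t, (ρ * ‖y r‖ + k r) := by
  rcases hst.eq_or_lt with rfl | hlt
  · simp
  have hT : 0 < T := by linarith
  -- Constant extension beyond `[0, T]`, so that Steklov averages and their derivatives make sense
  -- for a globally continuous function.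
  set Y : ℝ → H := Set.IccExtend hT.le (fun x : Set.Icc 0 T => y x) with hYdef
  have hY : Continuous Y := (continuousOn_iff_continuous_domRestrict.1 hy).Icc_extend'
  have hYy : ∀ r ∈ Set.Icc 0 T, Y r = y r := fun r hr => Set.IccExtend_of_mem _ _ hr
  set w : ℝ → ℝ := (Set.Ioo 0 T).indicator fun r => ρ * ‖Y r‖ + k r with hwdef
  have hw0 : IntegrableOn (fun r => ρ * ‖Y r‖ + k r) (Set.Ioo 0 T) :=
    (((hY.norm.const_smul ρ).integrableOn_Icc).mono_set Set.Ioo_subset_Icc_self).add hk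
  have hw : Integrable w := hw0.integrable_indicator measurableSet_Ioo
  set W : ℝ → ℝ := fun t => ∫ r in (0 : ℝ)..t, w r with hWdef
  have hW : Continuous W := intervalIntegral.continuous_primitive
    (fun a b => hw.intervalIntegrable) 0
  have hwsub : ∀ a b, W b - W a = ∫ r in a..b, w r := fun a b =>
    intervalIntegral.integral_interval_sub_left hw.intervalIntegrable hw.intervalIntegrable
  have hww : ∀ a b, 0 ≤ a → a ≤ b → b ≤ T →
      ∫ r in a..b, w r = ∫ r in a..b, (ρ * ‖y r‖ + k r) := by
    intro a b ha hab hb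
    rw [intervalIntegral.integral_of_le hab, intervalIntegral.integral_of_le hab,
      integral_Ioc_eq_integral_Ioo, integral_Ioc_eq_integral_Ioo]
    refine setIntegral_congr_fun measurableSet_Ioo fun r hr => ?_
    have hr' : r ∈ Set.Ioo 0 T := ⟨ha.trans_lt hr.1, hr.2.trans_le hb⟩
    simp only [hwdef, Set.indicator_of_mem hr']
    rw [hYy r ⟨hr'.1.le, hr'.2.le⟩]
  suffices hanti : AntitoneOn (fun r => e * ‖Y r‖ - W r) (Set.Icc 0 T) by
    have h1 := hanti ⟨hs, hst.trans ht⟩ ⟨hs.trans hst, ht⟩ hst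
    have h2 := hwsub s t
    rw [hww s t hs hst ht] at h2
    simp only at h1
    rw [hYy s ⟨hs, hst.trans ht⟩, hYy t ⟨hs.trans hst, ht⟩] at h1
    linarith
  refine antitoneOn_Icc_of_Ioo ((continuous_const.mul hY.norm).sub hW) ?_
  clear! s t
  intro s hs t ht hst
  -- The norm is not differentiable at zero; adding `h ^ 2` under the root regularises it, with the
  -- averaging length itself as the vanishing parameter.
  have hlim : ∀ r, Tendsto
      (fun h => e * √(‖steklov h Y r‖ ^ 2 + h ^ 2) - steklov h W r) (𝓝[>] 0)
      (𝓝 (e * ‖Y r‖ - W r)) := by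
    intro r
    refine Tendsto.sub (Tendsto.const_mul e ?_) (tendsto_steklov hW r)
    have h1 : Tendsto (fun h : ℝ => h ^ 2) (𝓝[>] 0) (𝓝 (0 ^ 2)) :=
      ((continuous_pow 2).tendsto 0).mono_left nhdsWithin_le_nhds
    have h2 := ((((tendsto_steklov hY r).norm.pow 2).add h1)).sqrt
    simpa using h2
  refine le_of_tendsto_of_tendsto (hlim t) (hlim s) ?_
  filter_upwards [Ioo_mem_nhdsGT (sub_pos.2 ht.2)] with h hh
  have hh0 : 0 < h := hh.1
  -- the pointwise estimate
  have key : ∀ r ∈ Set.Icc s t, e * ⟪steklov h Y r, h⁻¹ • (Y (r + h) - Y r)⟫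
      ≤ ‖steklov h Y r‖ * (h⁻¹ • (W (r + h) - W r)) := by
    intro r hr
    have hr0 : 0 < r := hs.1.trans_le hr.1
    have hrT : r + h < T := by linarith [hr.2, hh.2]
    have hrh : r ≤ r + h := by linarith
    have hsub : Set.Ioc r (r + h) ⊆ Set.Ioo 0 T := fun x hx =>
      ⟨hr0.trans hx.1, hx.2.trans_lt hrT⟩
    have hmem : r ∈ Set.Ioo 0 T := ⟨hr0, hrh.trans_lt hrT⟩
    have hmem' : r + h ∈ Set.Ioo 0 T := ⟨hr0.trans_le hrh, hrT⟩
    have hyVi : IntervalIntegrable yV volume r (r + h) :=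
      (intervalIntegrable_iff_integrableOn_Ioc_of_le hrh).2 (hyV.mono_set hsub)
    have hdi : IntervalIntegrable d volume r (r + h) :=
      (intervalIntegrable_iff_integrableOn_Ioc_of_le hrh).2 (hd.mono_set hsub)
    -- The average taken in `V` is an admissible test vector, and its image in `H` is the average of
    -- `Y`.
    set v : V := steklov h yV r with hv
    have hιv : ι v = steklov h Y r := by
      rw [hv, steklov, steklov, map_smul, ← ContinuousLinearMap.intervalIntegral_comp_comm _ hyVi]
      congr 1
      rw [intervalIntegral.integral_of_le hrh, intervalIntegral.integral_of_le hrh]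
      refine integral_congr_ae ?_
      filter_upwards [ae_restrict_of_ae_restrict_of_subset hsub hrepr,
        ae_restrict_mem measurableSet_Ioc] with x hx hx'
      rw [hx, hYy x ⟨(hsub hx').1.le, (hsub hx').2.le⟩]
    -- `F` is only given pointwise, with no measurability, so a scalar inequality is integrated
    -- rather than the equation.
    have hbd : ∀ᵐ x ∂volume.restrict (Set.Ioc r (r + h)),
        (e • d x) v - L (yV x) v ≤ ‖ι v‖ * k x := by
      filter_upwards [ae_restrict_of_ae_restrict_of_subset hsub heq] with x hx
      obtain ⟨F, hF, hFk⟩ := hx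
      rw [hF, add_apply, add_sub_cancel_left, dualEmb_apply]
      calc ⟪F, ι v⟫ ≤ ‖F‖ * ‖ι v‖ := real_inner_le_norm _ _
        _ ≤ k x * ‖ι v‖ := by gcongr
        _ = _ := mul_comm _ _
    have hki : IntervalIntegrable k volume r (r + h) :=
      (intervalIntegrable_iff_integrableOn_Ioc_of_le hrh).2 (hk.mono_set hsub)
    have hde : IntervalIntegrable (fun x => e • d x) volume r (r + h) := hdi.smul e
    have hdv : IntervalIntegrable (fun x => (e • d x) v) volume r (r + h) :=
      ⟨hde.1.apply_continuousLinearMap v, hde.2.apply_continuousLinearMap v⟩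
    have hLy : IntervalIntegrable (fun x => L (yV x)) volume r (r + h) :=
      ⟨L.integrable_comp hyVi.1, L.integrable_comp hyVi.2⟩
    have hLv : IntervalIntegrable (fun x => L (yV x) v) volume r (r + h) :=
      ⟨hLy.1.apply_continuousLinearMap v, hLy.2.apply_continuousLinearMap v⟩
    have hint : (∫ x in r..r + h, ((e • d x) v - L (yV x) v))
        ≤ ∫ x in r..r + h, ‖ι v‖ * k x :=
      intervalIntegral.integral_mono_ae_restrict hrh (hdv.sub hLv) (hki.const_mul _) (by
        rw [← restrict_Ioc_eq_restrict_Icc]; exact hbd)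
    rw [intervalIntegral.integral_sub hdv hLv, intervalIntegral.integral_const_mul,
      ← ContinuousLinearMap.intervalIntegral_apply hLy v,
      ContinuousLinearMap.intervalIntegral_comp_comm L hyVi,
      ← ContinuousLinearMap.intervalIntegral_apply hde v,
      intervalIntegral.integral_smul, ← hyd r hmem _ hmem' hrh] at hint
    have hLvv : L (∫ x in r..r + h, yV x) v = h * L v v := by
      have : (∫ x in r..r + h, yV x) = h • v := by
        rw [hv, steklov, smul_smul, mul_inv_cancel₀ hh0.ne', one_smul]
      rw [this, map_smul, smul_apply, smul_eq_mul]
    have hnv : h * ‖ι v‖ ≤ ∫ x in r..r + h, ‖Y x‖ := by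
      rw [hιv, steklov, norm_smul, norm_inv, Real.norm_of_nonneg hh0.le, ← mul_assoc,
        mul_inv_cancel₀ hh0.ne', one_mul]
      exact intervalIntegral.norm_integral_le_integral_norm hrh
    have hWr : W (r + h) - W r = ρ * (∫ x in r..r + h, ‖Y x‖) + ∫ x in r..r + h, k x := by
      rw [hwsub, hww r (r + h) hr0.le hrh hrT.le, ← intervalIntegral.integral_const_mul,
        ← intervalIntegral.integral_add ((hY.norm.intervalIntegrable _ _).const_mul ρ) hki]
      refine intervalIntegral.integral_congr fun x hx => ?_
      rw [Set.uIcc_of_le hrh] at hx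
      rw [hYy x ⟨hr0.le.trans hx.1, hx.2.trans hrT.le⟩]
    have hinner : (e • (dualEmb ι (y (r + h)) - dualEmb ι (y r))) v
        = e * ⟪Y (r + h) - Y r, ι v⟫ := by
      rw [hYy _ ⟨hmem'.1.le, hmem'.2.le⟩, hYy _ ⟨hmem.1.le, hmem.2.le⟩, ← map_sub,
        smul_apply, dualEmb_apply, smul_eq_mul]
    rw [hinner, hLvv] at hint
    rw [← hιv, inner_smul_right, smul_eq_mul, hWr, real_inner_comm]
    have hLρ := hL v
    have hn : 0 ≤ ‖ι v‖ := norm_nonneg _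
    have h3 : h * L v v ≤ ‖ι v‖ * (ρ * ∫ x in r..r + h, ‖Y x‖) := by
      calc h * L v v ≤ h * (ρ * ‖ι v‖ ^ 2) := by gcongr
        _ = ‖ι v‖ * (ρ * (h * ‖ι v‖)) := by ring
        _ ≤ _ := by gcongr
    have h4 : e * ⟪Y (r + h) - Y r, ι v⟫
        ≤ ‖ι v‖ * (ρ * (∫ x in r..r + h, ‖Y x‖) + ∫ x in r..r + h, k x) := by linarith
    calc e * (h⁻¹ * ⟪Y (r + h) - Y r, ι v⟫) = h⁻¹ * (e * ⟪Y (r + h) - Y r, ι v⟫) := by ring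
      _ ≤ h⁻¹ * (‖ι v‖ * (ρ * (∫ x in r..r + h, ‖Y x‖) + ∫ x in r..r + h, k x)) := by gcongr
      _ = _ := by ring
  have hkpos : ∀ᵐ x ∂volume.restrict (Set.Ioo 0 T), 0 ≤ w x := by
    filter_upwards [heq, ae_restrict_mem measurableSet_Ioo] with x hx hx'
    obtain ⟨F, -, hF⟩ := hx
    have : 0 ≤ k x := (norm_nonneg _).trans hF
    simp only [hwdef, Set.indicator_of_mem hx']
    positivity
  -- The derivative of the regularised norm carries the factor `‖a‖ / √(‖a‖² + h²) ≤ 1`; dropping it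
  -- is legitimate only because the increments of `W` are nonnegative.
  have hWnonneg : ∀ r ∈ Set.Icc s t, 0 ≤ W (r + h) - W r := by
    intro r hr
    have hrh : r ≤ r + h := by linarith
    rw [hwsub, intervalIntegral.integral_of_le hrh]
    refine integral_nonneg_of_ae (ae_restrict_of_ae_restrict_of_subset ?_ hkpos)
    exact fun x hx => ⟨(hs.1.trans_le hr.1).trans hx.1, hx.2.trans_lt (by linarith [hr.2, hh.2])⟩
  have hpos : ∀ r, 0 < ‖steklov h Y r‖ ^ 2 + h ^ 2 := fun r => by positivity
  have hderiv : ∀ r, HasDerivAt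
      (fun r => e * √(‖steklov h Y r‖ ^ 2 + h ^ 2) - steklov h W r)
      (e * ((2 * ⟪steklov h Y r, h⁻¹ • (Y (r + h) - Y r)⟫)
        / (2 * √(‖steklov h Y r‖ ^ 2 + h ^ 2))) - h⁻¹ • (W (r + h) - W r)) r := fun r =>
    ((((hasDerivAt_steklov h hY r).norm_sq.add_const _).sqrt (hpos r).ne').const_mul e).sub
      (hasDerivAt_steklov h hW r)
  refine antitoneOn_of_deriv_nonpos (convex_Icc s t)
    (fun r _ => (hderiv r).continuousAt.continuousWithinAt)
    (fun r _ => (hderiv r).differentiableAt.differentiableWithinAt) (fun r hr => ?_)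
    (Set.left_mem_Icc.2 hst) (Set.right_mem_Icc.2 hst) hst
  rw [interior_Icc] at hr
  have hr' : r ∈ Set.Icc s t := ⟨hr.1.le, hr.2.le⟩
  rw [(hderiv r).deriv, sub_nonpos, mul_div_mul_left _ _ two_ne_zero, ← mul_div_assoc,
    div_le_iff₀ (Real.sqrt_pos.2 (hpos r))]
  refine (key r hr').trans ?_
  rw [mul_comm]
  refine mul_le_mul_of_nonneg_left (Real.le_sqrt_of_sq_le (by nlinarith [sq_nonneg h])) ?_
  exact smul_nonneg (inv_nonneg.2 hh0.le) (hWnonneg r hr')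

end Energy

/-- Grönwall's inequality in integral form. -/
theorem gronwall_integral {u : ℝ → ℝ} {T K c : ℝ} (hu : ContinuousOn u (Set.Icc 0 T))
    (hc : 0 ≤ c) (hK : 0 ≤ K)
    (h : ∀ t ∈ Set.Icc 0 T, u t ≤ K + c * ∫ r in (0 : ℝ)..t, u r) {t : ℝ}
    (ht : t ∈ Set.Icc 0 T) : u t ≤ K * Real.exp (c * T) := by
  have hT : 0 ≤ T := ht.1.trans ht.2
  set Y : ℝ → ℝ := Set.IccExtend hT (fun x : Set.Icc 0 T => u x) with hYdef
  have hY : Continuous Y := (continuousOn_iff_continuous_domRestrict.1 hu).Icc_extend'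
  have hYu : ∀ r ∈ Set.Icc 0 T, Y r = u r := fun r hr => Set.IccExtend_of_mem _ _ hr
  have hI : ∀ r ∈ Set.Icc 0 T, ∫ q in (0 : ℝ)..r, u q = ∫ q in (0 : ℝ)..r, Y q := by
    intro r hr
    refine intervalIntegral.integral_congr fun x hx => ?_
    rw [Set.uIcc_of_le hr.1] at hx
    exact (hYu x ⟨hx.1, hx.2.trans hr.2⟩).symm
  have hP : ∀ t, HasDerivAt (fun t => K + c * ∫ r in (0 : ℝ)..t, Y r) (c * Y t) t := fun t =>
    ((intervalIntegral.integral_hasDerivAt_right (hY.intervalIntegrable _ _)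
      (hY.stronglyMeasurableAtFilter _ _) hY.continuousAt).const_mul c).const_add K
  -- The differential form is applied to the right-hand side of the integral inequality, which is
  -- differentiable although `u` need not be.
  have hG := le_gronwallBound_of_liminf_deriv_right_le (a := 0) (b := T) (δ := K) (K := c)
    (ε := 0) (f := fun t => K + c * ∫ r in (0 : ℝ)..t, Y r) (f' := fun t => c * Y t)
    (fun t _ => (hP t).continuousAt.continuousWithinAt)
    (fun x _ r hr => (hP x).hasDerivWithinAt.liminf_right_slope_le hr) (by simp)
    (fun x hx => by
      have hx' : x ∈ Set.Icc 0 T := ⟨hx.1, hx.2.le⟩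
      have := h x hx'
      rw [hI x hx', ← hYu x hx'] at this
      simpa using mul_le_mul_of_nonneg_left this hc) t ht
  have h1 := h t ht
  rw [hI t ht] at h1
  rw [gronwallBound_ε0, sub_zero] at hG
  refine (h1.trans hG).trans ?_
  gcongr
  exact ht.2

/-! ### The resolvent of the part of `L` in `H` -/

section Resolvent

variable {V H : Type*} [NormedAddCommGroup V] [InnerProductSpace ℝ V]
  [NormedAddCommGroup H] [InnerProductSpace ℝ H]

/-- `(x, z)` lies in the graph of the part of `L` in `H`. -/
def InGraph (ι : V →L[ℝ] H) (L : V →L[ℝ] StrongDual ℝ V) (x z : H) : Prop :=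
  ∃ v, ι v = x ∧ dualEmb ι z = L v

theorem InGraph.exists_mem_domH {ι : V →L[ℝ] H} (hι : DenseRange ι)
    {L : V →L[ℝ] StrongDual ℝ V} {x z : H} (h : InGraph ι L x z) :
    ∃ v ∈ domH ι L, ι v = x ∧ partH ι L v = z := by
  obtain ⟨v, hv, hz⟩ := h
  have hmem : v ∈ domH ι L := ⟨z, hz⟩
  exact ⟨v, hmem, hv, dualEmb_injective hι ((dualEmb_partH hmem).trans hz.symm)⟩

variable [CompleteSpace V] [CompleteSpace H]

/-- For `τ ρ < 1` the form `⟪ι v, ι w⟫ - τ ⟨L v, w⟩` is coercive on `V`, so Lax–Milgram yields `K =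
(1 - τ L)⁻¹`. The second clause says that `K` commutes with `L` on its graph; the third follows by
testing with `K x`. -/
theorem exists_resolvent {ι : V →L[ℝ] H} (hι : DenseRange ι) {L : V →L[ℝ] StrongDual ℝ V}
    {ρ θ τ : ℝ} (hθ : 0 < θ) (hL : ∀ v, θ * ‖v‖ ^ 2 + L v v ≤ ρ * ‖ι v‖ ^ 2)
    (hτ : 0 < τ) (hτρ : τ * ρ < 1) :
    ∃ K : H →L[ℝ] H, (∀ x, InGraph ι L (K x) (τ⁻¹ • (K x - x))) ∧
      (∀ x z, InGraph ι L x z → InGraph ι L (K x) (K z) ∧ x = K x - τ • K z) ∧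
      (∀ x, ‖K x‖ ≤ (1 - τ * ρ)⁻¹ * ‖x‖) ∧ DenseRange K := by
  set b : V →L[ℝ] V →L[ℝ] ℝ := (dualEmb ι).comp ι - τ • L with hb
  have hbapp : ∀ v w, b v w = ⟪ι v, ι w⟫ - τ * L v w := fun v w => rfl
  have hbco : ∀ v, τ * θ * ‖v‖ ^ 2 + (1 - τ * ρ) * ‖ι v‖ ^ 2 ≤ b v v := by
    intro v
    rw [hbapp, real_inner_self_eq_norm_sq]
    nlinarith [mul_le_mul_of_nonneg_left (hL v) hτ.le]
  have hcoer : IsCoercive b := by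
    refine ⟨τ * θ, mul_pos hτ hθ, fun v => ?_⟩
    have h1 : 0 ≤ (1 - τ * ρ) * ‖ι v‖ ^ 2 := mul_nonneg (by linarith) (sq_nonneg _)
    nlinarith [hbco v]
  set E := hcoer.continuousLinearEquivOfBilin with hE
  set J : H →L[ℝ] V :=
    (E.symm : V →L[ℝ] V).comp (ContinuousLinearMap.adjoint ι) with hJ
  have hJapp : ∀ x w, ⟪ι (J x), ι w⟫ - τ * L (J x) w = ⟪x, ι w⟫ := by
    intro x w
    rw [← hbapp, ← hcoer.continuousLinearEquivOfBilin_apply]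
    change ⟪E (E.symm (ContinuousLinearMap.adjoint ι x)), w⟫ = _
    rw [E.apply_symm_apply, ContinuousLinearMap.adjoint_inner_left]
  have hJuniq : ∀ x v, (∀ w, ⟪ι v, ι w⟫ - τ * L v w = ⟪x, ι w⟫) → J x = v := by
    intro x v h
    have h1 : E v = ContinuousLinearMap.adjoint ι x := by
      refine ext_inner_right ℝ fun w => ?_
      rw [ContinuousLinearMap.adjoint_inner_left, ← h w, ← hbapp]
      exact hcoer.continuousLinearEquivOfBilin_apply v w
    change E.symm (ContinuousLinearMap.adjoint ι x) = v
    rw [← h1, E.symm_apply_apply]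
  have hLJ : ∀ x, dualEmb ι (τ⁻¹ • (ι (J x) - x)) = L (J x) := by
    intro x
    ext w
    rw [dualEmb_apply, real_inner_smul_left, inner_sub_left, ← hJapp x w]
    field_simp
    ring
  refine ⟨ι.comp J, fun x => ⟨J x, rfl, hLJ x⟩, ?_, ?_, ?_⟩
  · rintro x z ⟨v, rfl, hz⟩
    have h1 : J (ι v - τ • z) = v := by
      refine hJuniq _ _ fun w => ?_
      rw [← hz, dualEmb_apply, inner_sub_left, real_inner_smul_left]
    have h2 : ι v = ι (J (ι v)) - τ • ι (J z) := by
      conv_lhs => rw [← h1]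
      simp
    refine ⟨⟨J (ι v), rfl, ?_⟩, h2⟩
    rw [← hLJ, ContinuousLinearMap.comp_apply]
    congr 1
    have h3 : ι (J (ι v)) - ι v = τ • ι (J z) := by
      nth_rewrite 2 [h2]
      abel
    rw [h3, smul_smul, inv_mul_cancel₀ hτ.ne', one_smul]
  · intro x
    have h0 : 0 < 1 - τ * ρ := by linarith
    have h1 := hbco (J x)
    rw [hbapp, hJapp] at h1
    have h2 : ⟪x, ι (J x)⟫ ≤ ‖x‖ * ‖ι (J x)‖ := real_inner_le_norm _ _
    have h3 : 0 ≤ τ * θ * ‖J x‖ ^ 2 := by positivity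
    rw [ContinuousLinearMap.comp_apply, inv_mul_eq_div, le_div_iff₀ h0]
    rcases (norm_nonneg (ι (J x))).eq_or_lt with h | h
    · rw [← h, zero_mul]
      exact norm_nonneg _
    · refine le_of_mul_le_mul_right ?_ h
      nlinarith
  · have hperp : ((ι.comp J).range)ᗮ = ⊥ := by
      rw [Submodule.eq_bot_iff]
      intro x hx
      have hx' : ⟪ι (J x), x⟫ = 0 :=
        (Submodule.mem_orthogonal _ _).1 hx _ ⟨x, rfl⟩
      have h1 := hbco (J x)
      rw [hbapp, hJapp, real_inner_comm, hx'] at h1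
      have h2 : 0 ≤ (1 - τ * ρ) * ‖ι (J x)‖ ^ 2 := mul_nonneg (by linarith) (sq_nonneg _)
      have h3 : ‖J x‖ ^ 2 ≤ 0 := by
        have : 0 < τ * θ := mul_pos hτ hθ
        by_contra hc
        nlinarith [mul_pos this (not_le.1 hc)]
      have h4 : J x = 0 := by
        rw [← norm_eq_zero]
        exact pow_eq_zero_iff two_ne_zero |>.1 (le_antisymm h3 (sq_nonneg _))
      refine hι.eq_zero_of_inner_left ℝ fun w => ?_
      rw [← hJapp x w, h4]
      simp
    exact (Submodule.dense_iff_topologicalClosure_eq_top).2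
      ((Submodule.topologicalClosure_eq_top_iff).2 hperp)

/-- A bounded operator with dense range has a square with dense range, and the range of `K²` lies in
the domain of the square. -/
theorem dense_graph_sq {ι : V →L[ℝ] H} (hι : DenseRange ι) {L : V →L[ℝ] StrongDual ℝ V}
    {ρ θ : ℝ} (hρ : 0 ≤ ρ) (hθ : 0 < θ) (hL : ∀ v, θ * ‖v‖ ^ 2 + L v v ≤ ρ * ‖ι v‖ ^ 2) :
    Dense {x | ∃ z u, InGraph ι L x z ∧ InGraph ι L z u} := by
  have hτ : 0 < (ρ + 1)⁻¹ := by positivity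
  obtain ⟨K, hK1, hK2, -, hK⟩ := exists_resolvent hι hθ hL hτ (by
    rw [inv_mul_lt_iff₀ (by positivity)]; linarith)
  refine (hK.comp hK K.continuous).mono ?_
  rintro _ ⟨y, rfl⟩
  exact ⟨_, _, (hK2 _ _ (hK1 y)).1, hK1 _⟩

end Resolvent

/-! ### A uniform bound for the Riccati solutions -/

section Riccati

variable {V H U : Type*} [NormedAddCommGroup V] [InnerProductSpace ℝ V]
  [NormedAddCommGroup H] [InnerProductSpace ℝ H]
  [NormedAddCommGroup U] [InnerProductSpace ℝ U] [CompleteSpace U]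

/-- Polarisation: `4 ⟪S x, y⟫` is the quadratic form at `x + y` minus the one at `x - y`, and the
latter is nonnegative. -/
theorem norm_le_of_isPositive {S : H →L[ℝ] H} (hS : S.IsPositive) {C : ℝ}
    (hSC : ∀ x, ⟪S x, x⟫ ≤ C * ‖x‖ ^ 2) (hC : 0 ≤ C) : ‖S‖ ≤ C := by
  refine S.opNorm_le_bound hC fun x => ?_
  have hpol : ∀ y, 4 * ⟪S x, y⟫ ≤ C * ‖x + y‖ ^ 2 := by
    intro y
    have h1 : 0 ≤ ⟪S (x - y), x - y⟫ := hS.inner_nonneg_left _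
    have h2 := hSC (x + y)
    have h3 : ⟪S y, x⟫ = ⟪S x, y⟫ := by
      rw [hS.inner_left_eq_inner_right, real_inner_comm]
    simp only [map_add, map_sub, inner_add_left, inner_add_right, inner_sub_left,
      inner_sub_right, h3] at h1 h2
    linarith
  rcases (norm_nonneg (S x)).eq_or_lt with h | h
  · rw [← h]
    positivity
  rcases (norm_nonneg x).eq_or_lt with hx | hx
  · rw [eq_comm, norm_eq_zero] at hx
    simp [hx]
  -- `S x` rescaled to the length of `x`, the choice that makes the estimate sharp.
  have h1 := hpol ((‖x‖ / ‖S x‖) • S x)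
  rw [real_inner_smul_right, real_inner_self_eq_norm_sq] at h1
  have h2 : ‖x + (‖x‖ / ‖S x‖) • S x‖ ≤ 2 * ‖x‖ := by
    refine (norm_add_le _ _).trans ?_
    rw [norm_smul, Real.norm_of_nonneg (by positivity), div_mul_cancel₀ _ h.ne']
    linarith
  have h3 : C * ‖x + (‖x‖ / ‖S x‖) • S x‖ ^ 2 ≤ C * (2 * ‖x‖) ^ 2 := by gcongr
  have h4 : ‖x‖ / ‖S x‖ * ‖S x‖ ^ 2 = ‖x‖ * ‖S x‖ := by field_simp
  rw [h4] at h1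
  refine le_of_mul_le_mul_left ?_ hx
  nlinarith

variable [CompleteSpace H] {ι : V →L[ℝ] H} {L : V →L[ℝ] StrongDual ℝ V} {B : U →L[ℝ] H} {Q P : H →L[ℝ] H}
  {T : ℝ} {S : ℝ → H →L[ℝ] H}

/-- A bound depending on `S`; it enters only the `O(τ²)` errors, which vanish in the limit. -/
theorem FeedbackUQ.IsRiccatiSolution.exists_norm_le (hS : IsRiccatiSolution ι L B Q P T S) :
    ∃ M, 0 ≤ M ∧ ∀ t ∈ Set.Icc 0 T, ‖S t‖ ≤ M := by
  obtain ⟨M, hM⟩ := banach_steinhaus (g := fun t : Set.Icc 0 T => S t) fun x => by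
    obtain ⟨C, hC⟩ := isCompact_Icc.exists_bound_of_continuousOn (hS.continuousOn x)
    exact ⟨C, fun t => hC t t.2⟩
  exact ⟨max M 0, le_max_right _ _, fun t ht => (hM ⟨t, ht⟩).trans (le_max_left _ _)⟩

theorem FeedbackUQ.IsRiccatiSolution.hasDerivWithinAt_inner (hι : DenseRange ι)
    (hS : IsRiccatiSolution ι L B Q P T S) {x z x' z' : H} (h : InGraph ι L x z)
    (h' : InGraph ι L x' z') {t : ℝ} (ht : t ∈ Set.Icc 0 T) :
    HasDerivWithinAt (fun s => ⟪S s x, x'⟫)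
      (⟪S t z, x'⟫ + ⟪S t x, z'⟫
        - ⟪S t (B (ContinuousLinearMap.adjoint B (S t x))), x'⟫
        + ⟪ContinuousLinearMap.adjoint Q (Q x), x'⟫) (Set.Icc 0 T) t := by
  obtain ⟨v, hv, rfl, rfl⟩ := h.exists_mem_domH hι
  obtain ⟨v', hv', rfl, rfl⟩ := h'.exists_mem_domH hι
  exact hS.hasDeriv v hv v' hv' t ht

/-- One backward Euler step. The first-order term `-2 τ ⟪S x, z⟫` from expanding at `x - τ z`
cancels the generator part of the derivative of `⟪S x, x⟫`, up to an error from comparing two times;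
controlling that error is why `z` must lie in the domain as well. The term `-‖B* S x‖²` is
discarded. -/
theorem FeedbackUQ.IsRiccatiSolution.step (hι : DenseRange ι)
    (hS : IsRiccatiSolution ι L B Q P T S) {M R : ℝ}
    (hM : ∀ t ∈ Set.Icc 0 T, ‖S t‖ ≤ M) {x z u : H} (hxz : InGraph ι L x z)
    (hzu : InGraph ι L z u) (hx : ‖x‖ ≤ R) (hz : ‖z‖ ≤ R) (hu : ‖u‖ ≤ R) {t τ : ℝ}
    (ht : 0 ≤ t) (hτ : 0 < τ) (htT : t + τ ≤ T) :
    ⟪S (t + τ) (x - τ • z), x - τ • z⟫ ≤ ⟪S t x, x⟫ + τ * (‖Q‖ ^ 2 * ‖x‖ ^ 2)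
      + τ ^ 2 * ((2 * (2 * M + M ^ 2 * ‖B‖ ^ 2 + ‖Q‖ ^ 2) + M) * R ^ 2) := by
  have hR : 0 ≤ R := (norm_nonneg _).trans hx
  have ht2 : t + τ ∈ Set.Icc 0 T := ⟨by linarith, htT⟩
  have hM0 : 0 ≤ M := (norm_nonneg _).trans (hM _ ht2)
  have hin : ∀ s ∈ Set.Icc 0 T, ∀ a b : H, ‖a‖ ≤ R → ‖b‖ ≤ R → |⟪S s a, b⟫| ≤ M * R ^ 2 := by
    intro s hs a b ha hb
    calc |⟪S s a, b⟫| ≤ ‖S s a‖ * ‖b‖ := abs_real_inner_le_norm _ _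
      _ ≤ (‖S s‖ * ‖a‖) * ‖b‖ := by gcongr; exact (S s).le_opNorm a
      _ ≤ (M * R) * R := by gcongr; exact hM s hs
      _ = M * R ^ 2 := by ring
  have hB : ∀ s ∈ Set.Icc 0 T, ∀ a : H, ‖a‖ ≤ R →
      ‖ContinuousLinearMap.adjoint B (S s a)‖ ≤ ‖B‖ * (M * R) := by
    intro s hs a ha
    calc ‖ContinuousLinearMap.adjoint B (S s a)‖
        ≤ ‖ContinuousLinearMap.adjoint B‖ * ‖S s a‖ := ContinuousLinearMap.le_opNorm _ _
      _ = ‖B‖ * ‖S s a‖ := by rw [LinearIsometryEquiv.norm_map]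
      _ ≤ ‖B‖ * (‖S s‖ * ‖a‖) := by gcongr; exact (S s).le_opNorm a
      _ ≤ _ := by gcongr; exact hM s hs
  have hBB : ∀ s ∈ Set.Icc 0 T, ∀ a b : H,
      ⟪S s (B (ContinuousLinearMap.adjoint B (S s a))), b⟫
      = ⟪ContinuousLinearMap.adjoint B (S s a), ContinuousLinearMap.adjoint B (S s b)⟫ := by
    intro s hs a b
    rw [(hS.isPositive s hs).inner_left_eq_inner_right, ← ContinuousLinearMap.adjoint_inner_right]
  have hQQ : ∀ a b : H, ⟪ContinuousLinearMap.adjoint Q (Q a), b⟫ = ⟪Q a, Q b⟫ := fun a b =>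
    ContinuousLinearMap.adjoint_inner_left _ _ _
  have hQ : ∀ a : H, ‖Q a‖ ≤ ‖Q‖ * ‖a‖ := Q.le_opNorm
  -- Lipschitz continuity of `⟪S x, z⟫`
  set c : ℝ := (2 * M + M ^ 2 * ‖B‖ ^ 2 + ‖Q‖ ^ 2) * R ^ 2 with hc
  have hlip : ∀ s ∈ Set.Icc t (t + τ), ⟪S s x, z⟫ ≤ ⟪S (t + τ) x, z⟫ + τ * c := by
    intro s hs
    have hs' : s ∈ Set.Icc 0 T := ⟨ht.trans hs.1, hs.2.trans htT⟩
    have := Convex.norm_image_sub_le_of_norm_hasDerivWithin_le (C := c) (𝕜 := ℝ)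
      (fun r hr => hS.hasDerivWithinAt_inner hι hxz hzu hr) (fun r hr => ?_)
      (convex_Icc 0 T) ht2 hs'
    · have h1 := (le_abs_self _).trans this
      have h2 : ‖s - (t + τ)‖ ≤ τ := by
        rw [Real.norm_eq_abs, abs_le]
        constructor <;> linarith [hs.1, hs.2]
      have h3 : c * ‖s - (t + τ)‖ ≤ c * τ := by gcongr
      linarith
    · rw [hBB r hr, hQQ]
      have h1 := abs_le.1 (hin r hr z z hz hz)
      have h2 := abs_le.1 (hin r hr x u hx hu)
      have h3 : |⟪ContinuousLinearMap.adjoint B (S r x),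
          ContinuousLinearMap.adjoint B (S r z)⟫| ≤ (‖B‖ * (M * R)) * (‖B‖ * (M * R)) :=
        (abs_real_inner_le_norm _ _).trans
          (mul_le_mul (hB r hr x hx) (hB r hr z hz) (norm_nonneg _) (by positivity))
      have h4 : |⟪Q x, Q z⟫| ≤ (‖Q‖ * R) * (‖Q‖ * R) := by
        refine (abs_real_inner_le_norm _ _).trans ?_
        have h5 : ‖Q x‖ ≤ ‖Q‖ * R := (hQ x).trans (by gcongr)
        have h6 : ‖Q z‖ ≤ ‖Q‖ * R := (hQ z).trans (by gcongr)
        exact mul_le_mul h5 h6 (norm_nonneg _) (by positivity)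
      have h3' := abs_le.1 h3
      have h4' := abs_le.1 h4
      rw [Real.norm_eq_abs, abs_le, hc]
      constructor <;> nlinarith
  -- mean value theorem for `⟪S x, x⟫`
  obtain ⟨ξ, hξ, hslope⟩ := exists_hasDerivAt_eq_slope (fun s => ⟪S s x, x⟫) _
    (show t < t + τ by linarith)
    (fun r hr => ((hS.hasDerivWithinAt_inner hι hxz hxz
      (show r ∈ Set.Icc 0 T from ⟨ht.trans hr.1, hr.2.trans htT⟩)).continuousWithinAt).mono
        (Set.Icc_subset_Icc ht htT))
    (fun r hr => (hS.hasDerivWithinAt_inner hι hxz hxz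
      (show r ∈ Set.Icc 0 T from ⟨ht.trans hr.1.le, hr.2.le.trans htT⟩)).hasDerivAt
        (Icc_mem_nhds (ht.trans_lt hr.1) (hr.2.trans_le htT)))
  have hξ' : ξ ∈ Set.Icc 0 T := ⟨ht.trans hξ.1.le, hξ.2.le.trans htT⟩
  have hsymm : ∀ s ∈ Set.Icc 0 T, ⟪S s z, x⟫ = ⟪S s x, z⟫ := fun s hs => by
    rw [(hS.isPositive s hs).inner_left_eq_inner_right, real_inner_comm]
  rw [add_sub_cancel_left, eq_div_iff hτ.ne', hBB ξ hξ', hQQ, hsymm ξ hξ',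
    real_inner_self_eq_norm_sq, real_inner_self_eq_norm_sq] at hslope
  have hexp : ⟪S (t + τ) (x - τ • z), x - τ • z⟫ = ⟪S (t + τ) x, x⟫
      - 2 * τ * ⟪S (t + τ) x, z⟫ + τ ^ 2 * ⟪S (t + τ) z, z⟫ := by
    simp only [map_sub, map_smul, inner_sub_left, inner_sub_right, real_inner_smul_left,
      real_inner_smul_right, hsymm _ ht2]
    ring
  have h1 := hlip ξ ⟨hξ.1.le, hξ.2.le⟩
  have h2 := (abs_le.1 (hin _ ht2 z z hz hz)).2
  have h3 : ‖Q x‖ ^ 2 ≤ ‖Q‖ ^ 2 * ‖x‖ ^ 2 := by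
    rw [← mul_pow]
    exact pow_le_pow_left₀ (norm_nonneg _) (hQ x) 2
  have h4 := sq_nonneg ‖ContinuousLinearMap.adjoint B (S ξ x)‖
  have h5 : ⟪S (t + τ) x, x⟫ - ⟪S t x, x⟫
      ≤ (2 * (⟪S (t + τ) x, z⟫ + τ * c) + ‖Q‖ ^ 2 * ‖x‖ ^ 2) * τ := by
    rw [← hslope]
    gcongr
    linarith
  have h6 : τ ^ 2 * ⟪S (t + τ) z, z⟫ ≤ τ ^ 2 * (M * R ^ 2) := by gcongr
  rw [hexp]
  rw [hc] at h5
  linarith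

variable [CompleteSpace V]

theorem inv_one_sub_le_exp {a : ℝ} (h0 : 0 ≤ a) (h : a ≤ 1 / 2) :
    (1 - a)⁻¹ ≤ Real.exp (2 * a) := by
  rw [inv_le_iff_one_le_mul₀ (by linarith)]
  nlinarith [Real.add_one_le_exp (2 * a)]

/-- With `τ = t / n`, the step is applied at `K^(k+1) x`, for which `x - τ z` becomes `K^k x`.
Chaining from time `t` down to `0` ends at `‖P K^n x‖²`. -/
theorem FeedbackUQ.IsRiccatiSolution.inner_le_of_inGraph (hι : DenseRange ι) {ρ θ : ℝ}
    (hρ : 0 ≤ ρ) (hθ : 0 < θ) (hL : ∀ v, θ * ‖v‖ ^ 2 + L v v ≤ ρ * ‖ι v‖ ^ 2)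
    (hS : IsRiccatiSolution ι L B Q P T S) {x z u : H} (hxz : InGraph ι L x z)
    (hzu : InGraph ι L z u) {t : ℝ} (ht : 0 < t) (htT : t ≤ T) :
    ⟪S t x, x⟫ ≤ (‖P‖ ^ 2 + T * ‖Q‖ ^ 2) * Real.exp (2 * ρ * T) ^ 2 * ‖x‖ ^ 2 := by
  obtain ⟨M, hM0, hM⟩ := hS.exists_norm_le
  set E := Real.exp (2 * ρ * T) with hE
  set R : ℝ := E * (‖x‖ + ‖z‖ + ‖u‖) with hR
  set c : ℝ := (2 * (2 * M + M ^ 2 * ‖B‖ ^ 2 + ‖Q‖ ^ 2) + M) * R ^ 2 with hc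
  have hEpos : 0 < E := Real.exp_pos _
  have key : ∀ᶠ n : ℕ in atTop, ⟪S t x, x⟫
      ≤ (‖P‖ ^ 2 + T * ‖Q‖ ^ 2) * E ^ 2 * ‖x‖ ^ 2 + t ^ 2 * c * (1 / (n : ℝ)) := by
    -- This choice makes `n` positive and `τ ρ ≤ 1/2`, so that `(1 - τ ρ)⁻¹ ≤ exp (2 τ ρ)` and all
    -- powers up to `n` are bounded by `E`.
    filter_upwards [eventually_ge_atTop (⌈2 * t * ρ⌉₊ + 1)] with n hn
    have hn0 : 0 < (n : ℝ) := by exact_mod_cast (by omega : 0 < n)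
    have hn1 : 2 * t * ρ ≤ n := by
      have := (Nat.le_ceil (2 * t * ρ))
      have h2 : ((⌈2 * t * ρ⌉₊ + 1 : ℕ) : ℝ) ≤ n := by exact_mod_cast hn
      push_cast at h2
      linarith
    set τ : ℝ := t / n with hτ
    have hτ0 : 0 < τ := div_pos ht hn0
    have hnτ : n * τ = t := by rw [hτ]; field_simp
    have hτρ : τ * ρ ≤ 1 / 2 := by
      rw [hτ, div_mul_eq_mul_div, div_le_iff₀ hn0]
      linarith
    obtain ⟨K, -, hK2, hK3, -⟩ := exists_resolvent hι hθ hL hτ0 (by linarith)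
    have hgr : ∀ k : ℕ, InGraph ι L ((K ^ k) x) ((K ^ k) z)
        ∧ InGraph ι L ((K ^ k) z) ((K ^ k) u) := by
      intro k
      induction k with
      | zero => exact ⟨hxz, hzu⟩
      | succ k ih =>
        simp only [pow_succ', mul_apply_eq_comp]
        exact ⟨(hK2 _ _ ih.1).1, (hK2 _ _ ih.2).1⟩
    have hKnorm : ∀ w : H, ∀ k : ℕ, k ≤ n → ‖(K ^ k) w‖ ≤ E * ‖w‖ := by
      intro w k hk
      have h1 : ∀ k : ℕ, ‖(K ^ k) w‖ ≤ Real.exp (2 * (τ * ρ)) ^ k * ‖w‖ := by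
        intro k
        induction k with
        | zero => simp
        | succ k ih =>
          rw [pow_succ', mul_apply_eq_comp, pow_succ', mul_assoc]
          refine (hK3 _).trans ?_
          have := inv_one_sub_le_exp (mul_nonneg hτ0.le hρ) hτρ
          gcongr
      refine (h1 k).trans ?_
      gcongr
      rw [← Real.exp_nat_mul, hE, Real.exp_le_exp]
      have hk' : (k : ℝ) ≤ n := by exact_mod_cast hk
      calc (k : ℝ) * (2 * (τ * ρ)) ≤ n * (2 * (τ * ρ)) := by gcongr
        _ = 2 * ρ * (n * τ) := by ring
        _ ≤ 2 * ρ * T := by rw [hnτ]; gcongr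
    have hR0 : ∀ w : H, ‖w‖ ≤ ‖x‖ + ‖z‖ + ‖u‖ → ∀ k ≤ n, ‖(K ^ k) w‖ ≤ R := fun w hw k hk =>
      (hKnorm w k hk).trans (by rw [hR]; gcongr)
    have hnx := norm_nonneg x
    have hnz := norm_nonneg z
    have hnu := norm_nonneg u
    have hstep : ∀ k : ℕ, k ≤ n → ⟪S t x, x⟫ ≤ ⟪S (t - k * τ) ((K ^ k) x), (K ^ k) x⟫
        + k * (τ * (‖Q‖ ^ 2 * (E ^ 2 * ‖x‖ ^ 2)) + τ ^ 2 * c) := by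
      intro k
      induction k with
      | zero => intro _; simp
      | succ k ih =>
        intro hk
        refine (ih (by omega)).trans ?_
        have hk' : ((k + 1 : ℕ) : ℝ) * τ ≤ t := by
          rw [← hnτ]
          gcongr
        have h1 := hS.step hι hM (hgr (k + 1)).1 (hgr (k + 1)).2
          (hR0 x (by linarith) _ hk) (hR0 z (by linarith) _ hk) (hR0 u (by linarith) _ hk)
          (t := t - (k + 1 : ℕ) * τ) (τ := τ) (by linarith) hτ0 (by push_cast; nlinarith)
        have h2 : (K ^ (k + 1)) x - τ • (K ^ (k + 1)) z = (K ^ k) x := by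
          simp only [pow_succ', mul_apply_eq_comp]
          exact ((hK2 _ _ (hgr k).1).2).symm
        have h3 : t - (k + 1 : ℕ) * τ + τ = t - k * τ := by push_cast; ring
        rw [h2, h3, ← hc] at h1
        have h4 : ‖(K ^ (k + 1)) x‖ ^ 2 ≤ E ^ 2 * ‖x‖ ^ 2 := by
          rw [← mul_pow]
          exact pow_le_pow_left₀ (norm_nonneg _) (hKnorm x _ hk) 2
        have h5 : τ * (‖Q‖ ^ 2 * ‖(K ^ (k + 1)) x‖ ^ 2)
            ≤ τ * (‖Q‖ ^ 2 * (E ^ 2 * ‖x‖ ^ 2)) := by gcongr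
        simp only [Nat.cast_add, Nat.cast_one] at h1 ⊢
        linarith
    have hfin := hstep n le_rfl
    rw [hnτ, sub_self, hS.initial, ContinuousLinearMap.comp_apply,
      ContinuousLinearMap.adjoint_inner_left, real_inner_self_eq_norm_sq] at hfin
    have hP : ‖P ((K ^ n) x)‖ ^ 2 ≤ ‖P‖ ^ 2 * (E ^ 2 * ‖x‖ ^ 2) := by
      rw [← mul_pow, ← mul_pow]
      refine pow_le_pow_left₀ (norm_nonneg _) ((P.le_opNorm _).trans ?_) 2
      gcongr
      exact hKnorm x n le_rfl
    have hn2 : n * (τ * (‖Q‖ ^ 2 * (E ^ 2 * ‖x‖ ^ 2)) + τ ^ 2 * c)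
        = t * (‖Q‖ ^ 2 * (E ^ 2 * ‖x‖ ^ 2)) + t ^ 2 * c * (1 / n) := by
      rw [hτ]; field_simp
    have hQt : t * (‖Q‖ ^ 2 * (E ^ 2 * ‖x‖ ^ 2)) ≤ T * (‖Q‖ ^ 2 * (E ^ 2 * ‖x‖ ^ 2)) := by
      gcongr
    rw [hn2] at hfin
    linarith
  have hlim : Tendsto (fun n : ℕ => (‖P‖ ^ 2 + T * ‖Q‖ ^ 2) * E ^ 2 * ‖x‖ ^ 2
      + t ^ 2 * c * (1 / (n : ℝ))) atTop
      (𝓝 ((‖P‖ ^ 2 + T * ‖Q‖ ^ 2) * E ^ 2 * ‖x‖ ^ 2 + t ^ 2 * c * 0)) :=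
    ((tendsto_one_div_atTop_nhds_zero_nat).const_mul _).const_add _
  simpa using ge_of_tendsto hlim key

theorem FeedbackUQ.IsRiccatiSolution.norm_le (hι : DenseRange ι) {ρ θ : ℝ}
    (hρ : 0 ≤ ρ) (hθ : 0 < θ) (hL : ∀ v, θ * ‖v‖ ^ 2 + L v v ≤ ρ * ‖ι v‖ ^ 2)
    (hS : IsRiccatiSolution ι L B Q P T S) {t : ℝ} (ht : t ∈ Set.Icc 0 T) :
    ‖S t‖ ≤ (‖P‖ ^ 2 + T * ‖Q‖ ^ 2) * Real.exp (2 * ρ * T) ^ 2 := by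
  have hT : 0 ≤ T := ht.1.trans ht.2
  refine norm_le_of_isPositive (hS.isPositive t ht) (fun x => ?_) (by positivity)
  rcases ht.1.eq_or_lt with rfl | h0
  · rw [hS.initial, ContinuousLinearMap.comp_apply, ContinuousLinearMap.adjoint_inner_left,
      real_inner_self_eq_norm_sq]
    have h1 : ‖P x‖ ^ 2 ≤ ‖P‖ ^ 2 * ‖x‖ ^ 2 := by
      rw [← mul_pow]
      exact pow_le_pow_left₀ (norm_nonneg _) (P.le_opNorm x) 2
    have h2 : 1 ≤ Real.exp (2 * ρ * T) ^ 2 := one_le_pow₀ (Real.one_le_exp (by positivity))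
    have h3 : ‖P‖ ^ 2 ≤ (‖P‖ ^ 2 + T * ‖Q‖ ^ 2) * Real.exp (2 * ρ * T) ^ 2 := by
      refine le_trans ?_ (le_mul_of_one_le_right (by positivity) h2)
      have : 0 ≤ T * ‖Q‖ ^ 2 := by positivity
      linarith
    exact h1.trans (by gcongr)
  · refine (dense_graph_sq hι hρ hθ hL).induction (P := fun x => ⟪S t x, x⟫ ≤ _ * ‖x‖ ^ 2) ?_
      (isClosed_le (by fun_prop) (by fun_prop)) x
    rintro x ⟨z, u, hxz, hzu⟩
    exact hS.inner_le_of_inGraph hι hρ hθ hL hxz hzu h0 ht.2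

end Riccati

/-! ### A priori bounds in `W_T(V, V')` -/

section Apriori

variable {V H : Type*} [NormedAddCommGroup V] [InnerProductSpace ℝ V]
  [NormedAddCommGroup H] [InnerProductSpace ℝ H]
  {ι : V →L[ℝ] H} {T : ℝ}

theorem FeedbackUQ.MemW.continuousOn_dualEmb {y : ℝ → H} {yV : ℝ → V}
    {dy : ℝ → StrongDual ℝ V} (hy : MemW ι T y yV dy) :
    ContinuousOn (fun t => dualEmb ι (y t)) (Set.Icc 0 T) :=
  (dualEmb ι).continuous.comp_continuousOn hy.continuousOn

theorem FeedbackUQ.HasWeakDeriv.sub {E : Type*} [NormedAddCommGroup E] [NormedSpace ℝ E]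
    {u u' v v' : ℝ → E} (h : HasWeakDeriv T u u') (h' : HasWeakDeriv T v v')
    (hu : ContinuousOn u (Set.Icc 0 T)) (hv : ContinuousOn v (Set.Icc 0 T))
    (hu' : IntegrableOn u' (Set.Ioo 0 T)) (hv' : IntegrableOn v' (Set.Ioo 0 T)) :
    HasWeakDeriv T (fun t => u t - v t) (fun t => u' t - v' t) := by
  intro φ hφ hφc hφs
  have hi : ∀ w : ℝ → E, ContinuousOn w (Set.Icc 0 T) →
      IntegrableOn (fun t => deriv φ t • w t) (Set.Ioo 0 T) := fun w hw =>
    (((hφ.continuous_deriv (by simp)).continuousOn.smul hw).integrableOn_Icc).mono_set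
      Set.Ioo_subset_Icc_self
  obtain ⟨C, hC⟩ := hφc.exists_bound_of_continuous hφ.continuous
  have hi' : ∀ w : ℝ → E, IntegrableOn w (Set.Ioo 0 T) →
      IntegrableOn (fun t => φ t • w t) (Set.Ioo 0 T) := fun w hw =>
    hw.bdd_smul C hφ.continuous.aestronglyMeasurable (Eventually.of_forall hC)
  simp_rw [smul_sub]
  rw [integral_sub (hi u hu) (hi v hv), integral_sub (hi' u' hu') (hi' v' hv'),
    h φ hφ hφc hφs, h' φ hφ hφc hφs]
  abel

theorem FeedbackUQ.MemW.sub {y y' : ℝ → H} {yV yV' : ℝ → V} {dy dy' : ℝ → StrongDual ℝ V}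
    (hy : MemW ι T y yV dy) (hy' : MemW ι T y' yV' dy') :
    MemW ι T (fun t => y t - y' t) (fun t => yV t - yV' t) (fun t => dy t - dy' t) where
  continuousOn := hy.continuousOn.sub hy'.continuousOn
  repr := by
    filter_upwards [hy.repr, hy'.repr] with t h h'
    rw [map_sub, h, h']
  memLp := hy.memLp.sub hy'.memLp
  memLp_deriv := hy.memLp_deriv.sub hy'.memLp_deriv
  weakDeriv := by
    simp_rw [map_sub]
    exact hy.weakDeriv.sub hy'.weakDeriv hy.continuousOn_dualEmb hy'.continuousOn_dualEmb
      (hy.memLp_deriv.integrable one_le_two) (hy'.memLp_deriv.integrable one_le_two)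

variable [CompleteSpace V] [CompleteSpace H] {L : V →L[ℝ] StrongDual ℝ V} {ρ c e : ℝ}
  {y : ℝ → H} {yV : ℝ → V} {dy : ℝ → StrongDual ℝ V} {k : ℝ → ℝ}

theorem FeedbackUQ.MemW.energy_inequality (hy : MemW ι T y yV dy) (hρ : 0 ≤ ρ)
    (hL : ∀ v, L v v ≤ ρ * ‖ι v‖ ^ 2) (hk : IntegrableOn k (Set.Ioo 0 T)) (hk0 : ∀ t, 0 ≤ k t)
    (heq : ∀ᵐ t ∂volume.restrict (Set.Ioo 0 T),
      ∃ F : H, e • dy t = L (yV t) + dualEmb ι F ∧ ‖F‖ ≤ c * ‖y t‖ + k t)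
    {s t : ℝ} (hs : 0 ≤ s) (hst : s ≤ t) (ht : t ≤ T) :
    e * (‖y t‖ - ‖y s‖) ≤ (ρ + c) * (∫ r in s..t, ‖y r‖) + ∫ r in Set.Ioo 0 T, k r := by
  have hyn : IntegrableOn (fun t => ‖y t‖) (Set.Ioo 0 T) :=
    (hy.continuousOn.norm.integrableOn_Icc).mono_set Set.Ioo_subset_Icc_self
  have hdy : IntegrableOn dy (Set.Ioo 0 T) := hy.memLp_deriv.integrable one_le_two
  have h := _root_.energy_inequality ι L hρ hL (k := fun t => c * ‖y t‖ + k t)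
    hy.continuousOn hy.repr (hy.memLp.integrable one_le_two) hdy
    (fun s hs t ht hst =>
      hy.weakDeriv.sub_eq_integral hy.continuousOn_dualEmb hdy hs ht hst)
    ((hyn.const_mul c).add hk) heq hs hst ht
  have hsub : Set.Ioo s t ⊆ Set.Ioo 0 T := Set.Ioo_subset_Ioo hs ht
  have hki : IntervalIntegrable k volume s t :=
    (intervalIntegrable_iff_integrableOn_Ioo_of_le hst).2 (hk.mono_set hsub)
  have hyi : IntervalIntegrable (fun r => ‖y r‖) volume s t :=
    (intervalIntegrable_iff_integrableOn_Ioo_of_le hst).2 (hyn.mono_set hsub)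
  have hle : ∫ r in s..t, k r ≤ ∫ r in Set.Ioo 0 T, k r := by
    rw [intervalIntegral.integral_of_le hst, integral_Ioc_eq_integral_Ioo]
    exact setIntegral_mono_set hk (Eventually.of_forall hk0) hsub.eventuallyLE
  have heq2 : ∫ r in s..t, (ρ * ‖y r‖ + (c * ‖y r‖ + k r))
      = (ρ + c) * (∫ r in s..t, ‖y r‖) + ∫ r in s..t, k r := by
    rw [← intervalIntegral.integral_const_mul,
      ← intervalIntegral.integral_add (hyi.const_mul _) hki]
    refine intervalIntegral.integral_congr fun r _ => ?_
    ring
  linarith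

theorem FeedbackUQ.MemW.norm_le_of_forward (hy : MemW ι T y yV dy) (hρ : 0 ≤ ρ) (hc : 0 ≤ c)
    (hL : ∀ v, L v v ≤ ρ * ‖ι v‖ ^ 2) (hk : IntegrableOn k (Set.Ioo 0 T)) (hk0 : ∀ t, 0 ≤ k t)
    (heq : ∀ᵐ t ∂volume.restrict (Set.Ioo 0 T),
      ∃ F : H, dy t = L (yV t) + dualEmb ι F ∧ ‖F‖ ≤ c * ‖y t‖ + k t)
    {t : ℝ} (ht : t ∈ Set.Icc 0 T) :
    ‖y t‖ ≤ (‖y 0‖ + ∫ r in Set.Ioo 0 T, k r) * Real.exp ((ρ + c) * T) := by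
  refine gronwall_integral hy.continuousOn.norm (add_nonneg hρ hc)
    (add_nonneg (norm_nonneg _) (integral_nonneg hk0)) (fun r hr => ?_) ht
  have := hy.energy_inequality (e := 1) hρ hL hk hk0 (by simpa only [one_smul] using heq)
    le_rfl hr.1 hr.2
  linarith

/-- The energy inequality with `e = -1` on `[T - r, T]` is a Grönwall inequality for the
time-reversed norm. -/
theorem FeedbackUQ.MemW.norm_le_of_backward (hy : MemW ι T y yV dy) (hρ : 0 ≤ ρ) (hc : 0 ≤ c)
    (hL : ∀ v, L v v ≤ ρ * ‖ι v‖ ^ 2) (hk : IntegrableOn k (Set.Ioo 0 T)) (hk0 : ∀ t, 0 ≤ k t)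
    (heq : ∀ᵐ t ∂volume.restrict (Set.Ioo 0 T),
      ∃ F : H, -dy t = L (yV t) + dualEmb ι F ∧ ‖F‖ ≤ c * ‖y t‖ + k t)
    {t : ℝ} (ht : t ∈ Set.Icc 0 T) :
    ‖y t‖ ≤ (‖y T‖ + ∫ r in Set.Ioo 0 T, k r) * Real.exp ((ρ + c) * T) := by
  have hcont : ContinuousOn (fun r => ‖y (T - r)‖) (Set.Icc 0 T) :=
    hy.continuousOn.norm.comp (f := fun r => T - r) (by fun_prop)
      fun r hr => ⟨by linarith [hr.2], by linarith [hr.1]⟩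
  have := gronwall_integral hcont (add_nonneg hρ hc)
    (add_nonneg (norm_nonneg (y T)) (integral_nonneg (μ := volume.restrict (Set.Ioo 0 T)) hk0))
    (fun r hr => ?_) (show T - t ∈ Set.Icc 0 T from ⟨by linarith [ht.2], by linarith [ht.1]⟩)
  · simpa only [sub_sub_cancel] using this
  · have := hy.energy_inequality (e := -1) (s := T - r) (t := T) hρ hL hk hk0
      (heq.mono fun t ⟨F, h, hF⟩ => ⟨F, (neg_one_smul ℝ (dy t)).trans h, hF⟩)
      (by linarith [hr.2]) (by linarith [hr.1]) le_rfl
    rw [intervalIntegral.integral_comp_sub_left (fun q => ‖y q‖), sub_zero]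
    linarith

end Apriori

/-! ### Bounds for the feedback -/

section Feedback

variable {H U : Type*} [NormedAddCommGroup H] [InnerProductSpace ℝ H]
  [NormedAddCommGroup U] [InnerProductSpace ℝ U]

instance : IsProbabilityMeasure paramMeasure := by
  unfold paramMeasure
  infer_instance

theorem zeroExt_mem_paramDomain {s : ℕ} {x : Fin s → ℝ}
    (hx : ∀ i, x i ∈ Set.Icc (-1 / 2 : ℝ) (1 / 2)) : zeroExt x ∈ paramDomain := by
  intro j
  unfold zeroExt
  split_ifs with h
  · exact hx _
  · norm_num

/-- Holds without measurability of `F`: the integral of a non-integrable function is `0` by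
convention. -/
theorem norm_setIntegral_paramDomain_le {E : Type*} [NormedAddCommGroup E] [NormedSpace ℝ E]
    {F : (ℕ → ℝ) → E} {C : ℝ} (hC : 0 ≤ C) (hF : ∀ σ ∈ paramDomain, ‖F σ‖ ≤ C) :
    ‖∫ σ in paramDomain, F σ ∂paramMeasure‖ ≤ C := by
  refine (norm_setIntegral_le_of_norm_le_const (measure_lt_top _ _) hF).trans ?_
  exact mul_le_of_le_one_right hC measureReal_le_one

theorem norm_sum_smul_le_of_norm_le {E : Type*} [NormedAddCommGroup E] [NormedSpace ℝ E] {N : ℕ}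
    {α : Fin N → ℝ} {v : Fin N → E} {κ C : ℝ} (hC : 0 ≤ C) (hα : ∑ k, |α k| ≤ κ)
    (hv : ∀ k, ‖v k‖ ≤ C) : ‖∑ k, α k • v k‖ ≤ κ * C :=
  calc ‖∑ k, α k • v k‖ ≤ ∑ k, |α k| * C := norm_sum_le_of_le _ fun k _ => by
        rw [norm_smul, Real.norm_eq_abs]
        exact mul_le_mul_of_nonneg_left (hv k) (abs_nonneg _)
    _ = (∑ k, |α k|) * C := by rw [Finset.sum_mul]
    _ ≤ κ * C := by gcongr

/-- The real supremum of an unbounded family is `0` by convention, so some upper bound has to be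
supplied. -/
theorem le_maxFeedbackError {T : ℝ} {M M' : ℝ → H →L[ℝ] U} {m m' : ℝ → U} {C : ℝ}
    (hC : ∀ t ∈ Set.Icc 0 T, ‖M (T - t) - M' (T - t)‖ + ‖m t - m' t‖ ≤ C) {t : ℝ}
    (ht : t ∈ Set.Icc 0 T) :
    ‖M (T - t) - M' (T - t)‖ + ‖m t - m' t‖ ≤ maxFeedbackError T M M' m m' :=
  le_ciSup (f := fun t : Set.Icc (0 : ℝ) T => ‖M (T - t) - M' (T - t)‖ + ‖m t - m' t‖)
    ⟨C, by rintro _ ⟨t, rfl⟩; exact hC t t.2⟩ ⟨t, ht⟩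

theorem norm_affineFeedback_sub_le (T : ℝ) (M M' : ℝ → H →L[ℝ] U) (m m' : ℝ → U) (t : ℝ)
    (z z' : H) :
    ‖affineFeedback T M m t z - affineFeedback T M' m' t z'‖ ≤ ‖M' (T - t)‖ * ‖z - z'‖
      + (‖M (T - t) - M' (T - t)‖ * ‖z‖ + ‖m t - m' t‖) := by
  have h : affineFeedback T M m t z - affineFeedback T M' m' t z'
      = -(M' (T - t) (z - z') + ((M (T - t) - M' (T - t)) z + (m t - m' t))) := by
    simp only [affineFeedback, map_sub, sub_apply]
    abel
  rw [h, norm_neg]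
  refine (norm_add_le _ _).trans (add_le_add ((M' (T - t)).le_opNorm _) ?_)
  exact (norm_add_le _ _).trans (add_le_add_left ((M (T - t) - M' (T - t)).le_opNorm _) _)

variable [CompleteSpace H] [CompleteSpace U]

theorem norm_adjoint_apply_le (B : U →L[ℝ] H) (x : H) :
    ‖ContinuousLinearMap.adjoint B x‖ ≤ ‖B‖ * ‖x‖ :=
  ((ContinuousLinearMap.adjoint B).le_opNorm x).trans_eq (by rw [LinearIsometryEquiv.norm_map])

theorem norm_adjoint_comp_le (B : U →L[ℝ] H) (S : H →L[ℝ] H) :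
    ‖(ContinuousLinearMap.adjoint B).comp S‖ ≤ ‖B‖ * ‖S‖ :=
  (ContinuousLinearMap.opNorm_comp_le _ _).trans_eq (by rw [LinearIsometryEquiv.norm_map])

end Feedback

/-! ### Uniform bound for the affine term -/

section AffineTerm

variable {V H U : Type*} [NormedAddCommGroup V] [InnerProductSpace ℝ V] [CompleteSpace V]
  [NormedAddCommGroup H] [InnerProductSpace ℝ H] [CompleteSpace H]
  [NormedAddCommGroup U] [InnerProductSpace ℝ U] [CompleteSpace U]

/-- `L.flip` has the same quadratic form as `L`, so the backward estimate applies with the same `ρ`.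
-/
theorem FeedbackUQ.IsAffineTerm.norm_le {ι : V →L[ℝ] H} {L : V →L[ℝ] StrongDual ℝ V}
    {B : U →L[ℝ] H} {T ρ C : ℝ} {f dg : ℝ → H} {g : ℝ → V} {S : ℝ → H →L[ℝ] H} {h : ℝ → H}
    {k : ℝ → ℝ} (hh : IsAffineTerm ι L B T f g dg S h) (hρ : 0 ≤ ρ) (hC : 0 ≤ C)
    (hL : ∀ v, L v v ≤ ρ * ‖ι v‖ ^ 2) (hS : ∀ t ∈ Set.Icc 0 T, ‖S t‖ ≤ C)
    (hk : IntegrableOn k (Set.Ioo 0 T)) (hk0 : ∀ t, 0 ≤ k t)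
    (hr : ∀ᵐ t ∂volume.restrict (Set.Ioo 0 T), ‖f t + partH ι L (g t) - dg t‖ ≤ k t)
    {t : ℝ} (ht : t ∈ Set.Icc 0 T) :
    ‖h t‖ ≤ (∫ r in Set.Ioo 0 T, C * k r) * Real.exp ((ρ + C * (‖B‖ * ‖B‖)) * T) := by
  obtain ⟨hV, dh, hW, hT, heq⟩ := hh
  have := hW.norm_le_of_backward (L := L.flip) (c := C * (‖B‖ * ‖B‖)) (k := fun r => C * k r)
    hρ (by positivity) (fun v => hL v) (hk.const_mul C) (fun t => mul_nonneg hC (hk0 t)) ?_ ht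
  · simpa [hT] using this
  filter_upwards [heq, hr, ae_restrict_mem measurableSet_Ioo] with t h1 h2 h3
  refine ⟨-S (T - t) (B (ContinuousLinearMap.adjoint B (h t)))
    + S (T - t) (f t + partH ι L (g t) - dg t), ?_, ?_⟩
  · rw [h1, map_add, map_neg]
    abel
  have hSt : ‖S (T - t)‖ ≤ C := hS _ ⟨by linarith [h3.2], by linarith [h3.1]⟩
  refine (norm_add_le _ _).trans (add_le_add ?_ ?_)
  · rw [norm_neg]
    calc ‖S (T - t) (B (ContinuousLinearMap.adjoint B (h t)))‖
        ≤ ‖S (T - t)‖ * ‖B (ContinuousLinearMap.adjoint B (h t))‖ := (S (T - t)).le_opNorm _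
      _ ≤ C * (‖B‖ * (‖B‖ * ‖h t‖)) := by
        gcongr
        exact (B.le_opNorm _).trans (by gcongr; exact norm_adjoint_apply_le B _)
      _ = _ := by ring
  · exact ((S (T - t)).le_opNorm _).trans (by gcongr)

end AffineTerm

/-! ### Closed-loop states: a priori bound and stability in the feedback -/

section ClosedLoop

variable {V H U : Type*} [NormedAddCommGroup V] [InnerProductSpace ℝ V] [CompleteSpace V]
  [NormedAddCommGroup H] [InnerProductSpace ℝ H] [CompleteSpace H]
  [NormedAddCommGroup U] [InnerProductSpace ℝ U]
  {ι : V →L[ℝ] H} {L : V →L[ℝ] StrongDual ℝ V} {B : U →L[ℝ] H} {T ρ : ℝ} {f : ℝ → H} {y₀ : H}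
  {M M' : ℝ → H →L[ℝ] U} {m m' : ℝ → U} {y y' : ℝ → H}

theorem FeedbackUQ.IsClosedLoop.norm_le (hy : IsClosedLoop ι L B T f y₀ (affineFeedback T M m) y)
    (hρ : 0 ≤ ρ) (hL : ∀ v, L v v ≤ ρ * ‖ι v‖ ^ 2) (hf : IntegrableOn f (Set.Ioo 0 T)) {c c' : ℝ}
    (hc : 0 ≤ c) (hc' : 0 ≤ c') (hM : ∀ t ∈ Set.Icc 0 T, ‖M t‖ ≤ c)
    (hm : ∀ t ∈ Set.Icc 0 T, ‖m t‖ ≤ c') {t : ℝ} (ht : t ∈ Set.Icc 0 T) :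
    ‖y t‖ ≤ (‖y₀‖ + ∫ r in Set.Ioo 0 T, (‖B‖ * c' + ‖f r‖)) * Real.exp ((ρ + ‖B‖ * c) * T) := by
  obtain ⟨yV, dy, hW, h0, heq⟩ := hy
  rw [← h0]
  refine hW.norm_le_of_forward (k := fun r => ‖B‖ * c' + ‖f r‖) hρ (by positivity) hL
    ((integrable_const _).add hf.norm) (fun t => by positivity) ?_ ht
  filter_upwards [heq, ae_restrict_mem measurableSet_Ioo] with t h1 h3
  refine ⟨_, h1, (norm_add_le _ _).trans ?_⟩
  have h4 : ‖affineFeedback T M m t (y t)‖ ≤ c * ‖y t‖ + c' := by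
    refine (norm_sub_le _ _).trans (add_le_add ?_ (hm t ⟨h3.1.le, h3.2.le⟩))
    rw [norm_neg]
    refine ((M (T - t)).le_opNorm _).trans ?_
    gcongr
    exact hM _ ⟨by linarith [h3.2], by linarith [h3.1]⟩
  have h5 : ‖B (affineFeedback T M m t (y t))‖ ≤ ‖B‖ * (c * ‖y t‖ + c') :=
    (B.le_opNorm _).trans (by gcongr)
  linarith

/-- The splitting is asymmetric: only `M'` acts on the difference and the error acts on `y`, so no
bound on `y'` is needed. In `r + 1`, `r` pays for the linear error and `1` for the affine one. -/
theorem norm_sub_le_of_isClosedLoop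
    (hy : IsClosedLoop ι L B T f y₀ (affineFeedback T M m) y)
    (hy' : IsClosedLoop ι L B T f y₀ (affineFeedback T M' m') y')
    (hρ : 0 ≤ ρ) (hL : ∀ v, L v v ≤ ρ * ‖ι v‖ ^ 2) {c r ε : ℝ} (hc : 0 ≤ c)
    (hM' : ∀ t ∈ Set.Icc 0 T, ‖M' t‖ ≤ c) (hr : ∀ t ∈ Set.Icc 0 T, ‖y t‖ ≤ r)
    (hε : ∀ t ∈ Set.Icc 0 T, ‖M (T - t) - M' (T - t)‖ + ‖m t - m' t‖ ≤ ε) {t : ℝ}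
    (ht : t ∈ Set.Icc 0 T) :
    ‖y t - y' t‖ ≤ T * ‖B‖ * (r + 1) * Real.exp ((ρ + ‖B‖ * c) * T) * ε ∧
    ‖affineFeedback T M m t (y t) - affineFeedback T M' m' t (y' t)‖
      ≤ (c * (T * ‖B‖ * (r + 1) * Real.exp ((ρ + ‖B‖ * c) * T)) + (r + 1)) * ε := by
  have hT : 0 ≤ T := ht.1.trans ht.2
  have hr0 : 0 ≤ r := (norm_nonneg _).trans (hr t ht)
  have hε0 : 0 ≤ ε := le_trans (by positivity) (hε t ht)
  have hfb : ∀ t ∈ Set.Icc 0 T,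
      ‖affineFeedback T M m t (y t) - affineFeedback T M' m' t (y' t)‖
        ≤ c * ‖y t - y' t‖ + (r + 1) * ε := by
    intro t ht
    have h1 := hM' (T - t) ⟨by linarith [ht.2], by linarith [ht.1]⟩
    have h2 := hε t ht
    have h3 : ‖M (T - t) - M' (T - t)‖ ≤ ε := le_trans (by linarith [norm_nonneg (m t - m' t)]) h2
    have h4 : ‖m t - m' t‖ ≤ ε :=
      le_trans (by linarith [norm_nonneg (M (T - t) - M' (T - t))]) h2
    calc _ ≤ _ := norm_affineFeedback_sub_le T M M' m m' t (y t) (y' t)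
      _ ≤ c * ‖y t - y' t‖ + (ε * r + ε) := by
        gcongr
        exact hr t ht
      _ = _ := by ring
  have hstate : ∀ t ∈ Set.Icc 0 T,
      ‖y t - y' t‖ ≤ T * ‖B‖ * (r + 1) * Real.exp ((ρ + ‖B‖ * c) * T) * ε := by
    intro t ht
    obtain ⟨yV, dy, hW, h0, heq⟩ := hy
    obtain ⟨yV', dy', hW', h0', heq'⟩ := hy'
    have := (hW.sub hW').norm_le_of_forward (L := L) (c := ‖B‖ * c)
      (k := fun _ => ‖B‖ * ((r + 1) * ε)) hρ (by positivity) hL (integrable_const _)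
      (fun t => by positivity) ?_ ht
    · refine this.trans_eq ?_
      simp only [h0, h0', sub_self, norm_zero, zero_add, setIntegral_const, smul_eq_mul,
        Real.volume_real_Ioo_of_le hT, sub_zero]
      ring
    · filter_upwards [heq, heq', ae_restrict_mem measurableSet_Ioo] with t h1 h2 h3
      refine ⟨B (affineFeedback T M m t (y t) - affineFeedback T M' m' t (y' t)), ?_, ?_⟩
      · rw [h1, h2]
        simp only [map_sub, map_add]
        abel
      · have h4 := hfb t ⟨h3.1.le, h3.2.le⟩
        calc _ ≤ ‖B‖ * ‖affineFeedback T M m t (y t) - affineFeedback T M' m' t (y' t)‖ :=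
              B.le_opNorm _
          _ ≤ ‖B‖ * (c * ‖y t - y' t‖ + (r + 1) * ε) := by gcongr
          _ = _ := by ring
  refine ⟨hstate t ht, (hfb t ht).trans ?_⟩
  have h1 : c * ‖y t - y' t‖
      ≤ c * (T * ‖B‖ * (r + 1) * Real.exp ((ρ + ‖B‖ * c) * T) * ε) := by
    gcongr
    exact hstate t ht
  linarith

end ClosedLoop

/-! ### Assembling the uniform constants -/

theorem FeedbackUQ.graphNorm_le {V H : Type*} [NormedAddCommGroup V] [InnerProductSpace ℝ V]
    [NormedAddCommGroup H] [InnerProductSpace ℝ H] (ι : V →L[ℝ] H) (L : V →L[ℝ] StrongDual ℝ V)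
    (v : V) : graphNorm ι L v ≤ ‖ι v‖ + ‖partH ι L v‖ := by
  refine Real.sqrt_le_iff.2 ⟨by positivity, ?_⟩
  nlinarith [mul_nonneg (norm_nonneg (ι v)) (norm_nonneg (partH ι L v))]

theorem mainTheorem7
    {V H U : Type*}
    [NormedAddCommGroup V] [InnerProductSpace ℝ V] [CompleteSpace V]
    [TopologicalSpace.SeparableSpace V]
    [NormedAddCommGroup H] [InnerProductSpace ℝ H] [CompleteSpace H]
    [TopologicalSpace.SeparableSpace H]
    [NormedAddCommGroup U] [InnerProductSpace ℝ U] [CompleteSpace U] [FiniteDimensional ℝ U]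
    -- the Gelfand triple `V ⊂ H ⊂ V'`
    (ι : V →L[ℝ] H) (hι_inj : Function.Injective ι) (hι_dense : DenseRange ι)
    (T : ℝ) (hT : 0 < T)
    (B : U →L[ℝ] H) (Q P : H →L[ℝ] H) (y₀ : H)
    -- the bilinear forms `a(σ; v, w)` and the operators `⟨A_σ v, w⟩ = -a(σ; v, w)`
    (a : (ℕ → ℝ) → V →L[ℝ] V →L[ℝ] ℝ)
    (A : (ℕ → ℝ) → V →L[ℝ] StrongDual ℝ V)
    (hA : ∀ σ ∈ paramDomain, ∀ v w : V, A σ v w = - a σ v w)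
    (hA_meas : ∀ v w : V, AEMeasurable (fun σ => A σ v w) (paramMeasure.restrict paramDomain))
    -- uniform coercivity
    (ρ θ : ℝ) (hθ : 0 < θ)
    (h_coercive : ∀ σ ∈ paramDomain, ∀ v : V, θ * ‖v‖ ^ 2 ≤ a σ v v + ρ * ‖ι v‖ ^ 2)
    -- uniform boundedness in `L(V, V')`
    (CA : ℝ) (h_bdd : ∀ σ ∈ paramDomain, ‖A σ‖ ≤ CA)
    -- `D(A_σ)` does not depend on `σ`, and `D(A_σ) = D(A_σ*)`
    (h_dom : ∀ σ ∈ paramDomain, domH ι (A σ) = domH ι (A 0))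
    (h_dom_adj : ∀ σ ∈ paramDomain, domH ι (A σ).flip = domH ι (A σ))
    -- `‖∂^ν A_σ‖_{L(D(A), H)} ≤ b^ν` for all multi-indices `ν ≠ 0`, with `b ∈ ℓ^p`
    (p : ℝ) (hp : 0 < p) (hp1 : p ≤ 1)
    (b : ℕ → ℝ) (hb : ∀ j, 0 ≤ b j) (hb_sum : Summable fun j => b j ^ p)
    (h_param : ∃ D : (ℕ →₀ ℕ) → (ℕ → ℝ) → V → H,
      ∀ v ∈ domH ι (A 0),
        IsMixedPartials (fun σ => partH ι (A σ) v) (fun ν σ => D ν σ v) ∧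
        ∀ ν : ℕ →₀ ℕ, ν ≠ 0 → ∀ σ ∈ paramDomain,
          ‖D ν σ v‖ ≤ (ν.prod fun j n => b j ^ n) * graphNorm ι (A 0) v)
    -- uniform boundedness in `L(D(A), H)`
    (CA' : ℝ) (h_bdd_dom : ∀ σ ∈ paramDomain, ∀ v ∈ domH ι (A 0),
      ‖partH ι (A σ) v‖ ≤ CA' * graphNorm ι (A 0) v)
    -- the external forcing and the target
    (f : ℝ → H) (hf : MemLp f 2 (MeasureTheory.volume.restrict (Set.Ioo 0 T)))
    (g : ℝ → V) (dg : ℝ → H) (hg : IsRegularTarget ι (A 0) T g dg)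
    (κ : ℝ) :
    ∃ C_y C_u : ℝ,
      -- the Riccati solutions `Π_σ` and the functions `h_σ`
      ∀ (S : (ℕ → ℝ) → ℝ → H →L[ℝ] H) (h : (ℕ → ℝ) → ℝ → H),
      (∀ σ ∈ paramDomain, IsRiccatiSolution ι (A σ) B Q P T (S σ)) →
      (∀ σ ∈ paramDomain, IsAffineTerm ι (A σ) B T f g dg (S σ) (h σ)) →
      -- the cubature rule
      ∀ (N s : ℕ) (α : Fin N → ℝ) (x : Fin N → Fin s → ℝ),
      ∑ k, |α k| ≤ κ →
      (∀ k i, x k i ∈ Set.Icc (-1 / 2 : ℝ) (1 / 2)) →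
      ∀ K K' : ℝ → H → U,
      K = affineFeedback T (meanLin B S) (meanAff B h) →
      K' = affineFeedback T (cubLin B S α x) (cubAff B h α x) →
      -- the closed-loop states and controls
      ∀ σ ∈ paramDomain, ∀ y y' : ℝ → H,
      IsClosedLoop ι (A σ) B T f y₀ K y →
      IsClosedLoop ι (A σ) B T f y₀ K' y' →
      ∀ t ∈ Set.Icc 0 T,
        ‖y t - y' t‖ ≤ C_y * maxFeedbackError T (meanLin B S) (cubLin B S α x)
          (meanAff B h) (cubAff B h α x) ∧
        ‖K t (y t) - K' t (y' t)‖ ≤ C_u * maxFeedbackError T (meanLin B S) (cubLin B S α x)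
          (meanAff B h) (cubAff B h α x) := by
  -- uniform bounds for `Π_σ` and `h_σ`
  have hL' : ∀ σ ∈ paramDomain, ∀ v, θ * ‖v‖ ^ 2 + A σ v v ≤ |ρ| * ‖ι v‖ ^ 2 := by
    intro σ hσ v
    have h1 := h_coercive σ hσ v
    have h2 := hA σ hσ v v
    have h3 : ρ * ‖ι v‖ ^ 2 ≤ |ρ| * ‖ι v‖ ^ 2 := by gcongr; exact le_abs_self ρ
    linarith
  have hL : ∀ σ ∈ paramDomain, ∀ v, A σ v v ≤ |ρ| * ‖ι v‖ ^ 2 := fun σ hσ v =>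
    le_trans (by have : 0 ≤ θ * ‖v‖ ^ 2 := by positivity
                 linarith) (hL' σ hσ v)
  set cS : ℝ := (‖P‖ ^ 2 + T * ‖Q‖ ^ 2) * Real.exp (2 * |ρ| * T) ^ 2 with hcS
  have hcS0 : 0 ≤ cS := by positivity
  -- A parameter-independent integrable majorant of `f + A_σ g - g'`, obtained from the uniform
  -- bound of `A_σ` on the common domain.
  set k : ℝ → ℝ := fun t =>
    ‖f t‖ + |CA'| * (‖ι (g t)‖ + ‖partH ι (A 0) (g t)‖) + ‖dg t‖ with hk
  have hf1 : IntegrableOn f (Set.Ioo 0 T) := hf.integrable one_le_two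
  have hki : IntegrableOn k (Set.Ioo 0 T) :=
    (hf1.norm.add (((hg.memLp.integrable one_le_two).norm.add
      (hg.memLp_op.integrable one_le_two).norm).const_mul _)).add
      (hg.memLp_deriv.integrable one_le_two).norm
  have hk0 : ∀ t, 0 ≤ k t := fun t => by positivity
  set cH : ℝ := (∫ r in Set.Ioo 0 T, cS * k r)
    * Real.exp ((|ρ| + cS * (‖B‖ * ‖B‖)) * T) with hcH
  have hcH0 : 0 ≤ cH := mul_nonneg
    (integral_nonneg fun t => mul_nonneg hcS0 (hk0 t)) (Real.exp_pos _).le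
  set r : ℝ := (‖y₀‖ + ∫ q in Set.Ioo 0 T, (‖B‖ * (‖B‖ * cH) + ‖f q‖))
    * Real.exp ((|ρ| + ‖B‖ * (‖B‖ * cS)) * T) with hr
  set c : ℝ := |κ| * (‖B‖ * cS) with hc
  have hc0 : 0 ≤ c := by positivity
  refine ⟨T * ‖B‖ * (r + 1) * Real.exp ((|ρ| + ‖B‖ * c) * T),
    c * (T * ‖B‖ * (r + 1) * Real.exp ((|ρ| + ‖B‖ * c) * T)) + (r + 1), ?_⟩
  rintro S h hS hh N s α x hα hx _ _ rfl rfl σ hσ y y' hy hy' t ht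
  have hακ : ∑ k, |α k| ≤ |κ| := hα.trans (le_abs_self κ)
  have hSb : ∀ σ ∈ paramDomain, ∀ t ∈ Set.Icc 0 T, ‖S σ t‖ ≤ cS := fun σ hσ t ht =>
    (hS σ hσ).norm_le hι_dense (abs_nonneg ρ) hθ (hL' σ hσ) ht
  have hhb : ∀ σ ∈ paramDomain, ∀ t ∈ Set.Icc 0 T, ‖h σ t‖ ≤ cH := by
    intro σ hσ t ht
    refine (hh σ hσ).norm_le (abs_nonneg ρ) hcS0 (hL σ hσ) (hSb σ hσ) hki hk0 ?_ ht
    filter_upwards [hg.mem_dom] with t h1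
    have h2 : ‖partH ι (A σ) (g t)‖ ≤ |CA'| * (‖ι (g t)‖ + ‖partH ι (A 0) (g t)‖) := by
      refine (h_bdd_dom σ hσ _ h1).trans ?_
      exact mul_le_mul (le_abs_self _) (graphNorm_le _ _ _) (Real.sqrt_nonneg _) (abs_nonneg _)
    calc _ ≤ ‖f t‖ + ‖partH ι (A σ) (g t)‖ + ‖dg t‖ :=
          (norm_sub_le _ _).trans (by gcongr; exact norm_add_le _ _)
      _ ≤ k t := add_le_add (add_le_add le_rfl h2) le_rfl
  have hBS : ∀ σ ∈ paramDomain, ∀ t ∈ Set.Icc 0 T,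
      ‖(ContinuousLinearMap.adjoint B).comp (S σ t)‖ ≤ ‖B‖ * cS := fun σ hσ t ht =>
    (norm_adjoint_comp_le B _).trans (by gcongr; exact hSb σ hσ t ht)
  have hBh : ∀ σ ∈ paramDomain, ∀ t ∈ Set.Icc 0 T,
      ‖ContinuousLinearMap.adjoint B (h σ t)‖ ≤ ‖B‖ * cH := fun σ hσ t ht =>
    (norm_adjoint_apply_le B _).trans (by gcongr; exact hhb σ hσ t ht)
  -- bounds for the mean and the cubature feedback
  have hM : ∀ t ∈ Set.Icc 0 T, ‖meanLin B S t‖ ≤ ‖B‖ * cS := fun t ht =>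
    norm_setIntegral_paramDomain_le (by positivity) fun σ hσ => hBS σ hσ t ht
  have hm : ∀ t ∈ Set.Icc 0 T, ‖meanAff B h t‖ ≤ ‖B‖ * cH := fun t ht =>
    norm_setIntegral_paramDomain_le (by positivity) fun σ hσ => hBh σ hσ t ht
  have hM' : ∀ t ∈ Set.Icc 0 T, ‖cubLin B S α x t‖ ≤ c := fun t ht =>
    norm_sum_smul_le_of_norm_le (by positivity) hακ
      fun k => hBS _ (zeroExt_mem_paramDomain (hx k)) t ht
  have hm' : ∀ t ∈ Set.Icc 0 T, ‖cubAff B h α x t‖ ≤ |κ| * (‖B‖ * cH) := fun t ht =>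
    norm_sum_smul_le_of_norm_le (by positivity) hακ
      fun k => hBh _ (zeroExt_mem_paramDomain (hx k)) t ht
  -- The constant `C` serves only to make the supremum finite; it does not enter `C_y` or `C_u`.
  refine norm_sub_le_of_isClosedLoop hy hy' (abs_nonneg ρ) (hL σ hσ) hc0 hM'
    (fun t ht => hy.norm_le (abs_nonneg ρ) (hL σ hσ) hf1 (by positivity) (by positivity) hM hm ht)
    (fun t ht => le_maxFeedbackError
      (C := (‖B‖ * cS + c) + (‖B‖ * cH + |κ| * (‖B‖ * cH))) (fun t ht => ?_) ht) ht
  have htT : T - t ∈ Set.Icc 0 T := ⟨by linarith [ht.2], by linarith [ht.1]⟩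
  exact add_le_add ((norm_sub_le _ _).trans (add_le_add (hM _ htT) (hM' _ htT)))
    ((norm_sub_le _ _).trans (add_le_add (hm t ht) (hm' t ht)))
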